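/- Let $\mathbb E^4_s$ be $\mathbb R^4$ with the inner product $\langle x,y\rangle=\sum_{i=1}^{4-s}x_iy_i-\sum_{i=5-s}^{4}x_iy_i$, where $0\le s\le 3$, and let $\mathbb S^3_s(1)=\{x\in\mathbb E^4_s : \langle x,x\rangle=1\}$ with the induced metric. Let $M$ be a connected smooth surface and $\mathbf x:M\to\mathbb E^4_s$ a smooth immersion with image in $\mathbb S^3_s(1)$ such that the metric induced on $M$ is Lorentzian and flat and the mean curvature vector field $H=\frac12\operatorname{tr}h$ of $M$ in $\mathbb S^3_s(1)$ vanishes, where $h$ is the second fundamental form of $M$ in $\mathbb S^3_s(1)$. Then $s\in\{1,2\}$, and there is a linear isometry $A$ of $\mathbb E^4_s$ (hence an isometry of $\mathbb S^3_s(1)$) such that $A(\mathbf x(M))$ is a relatively open subset of the image of the map defined on $\mathbb R^2$ by (i) $(u,v)\mapsto\frac1{\sqrt2}(\cos u,\sin u,\cosh v,\sinh v)$ if $s=1$; (ii) $(u,v)\mapsto(\cosh u\cos v,\ \cosh u\sin v,\ \sinh u\cos v,\ \sinh u\sin v)$ if $s=2$. -/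

import Mathlib

open scoped Manifold ContDiff Matrix

noncomputable section

/-- The inner product `∑_{i ≤ m-s} x_i y_i - ∑_{i > m-s} x_i y_i` of the pseudo-Euclidean space
`𝔼^m_s`, that is, of `ℝ^m` with index `s`. -/
def pseudoInner {m : ℕ} (s : ℕ) (x y : Fin m → ℝ) : ℝ :=
  ∑ i : Fin m, (if i.val + s < m then (1 : ℝ) else -1) * (x i * y i)

/-- The pseudo-sphere `𝕊^m_s(c) = {x ∈ 𝔼^{m+1}_s | ⟨x, x⟩ = c⁻¹}` (for `c > 0`). -/
def pseudoSphere (m s : ℕ) (c : ℝ) : Set (Fin (m + 1) → ℝ) :=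
  {x | pseudoInner s x x = c⁻¹}

/-- The `i`-th partial derivative of a map defined on `ℝ^n`. -/
def partialD {n : ℕ} {V : Type*} [NormedAddCommGroup V] [NormedSpace ℝ V] (i : Fin n)
    (F : EuclideanSpace ℝ (Fin n) → V) (y : EuclideanSpace ℝ (Fin n)) : V :=
  fderiv ℝ F y (EuclideanSpace.single i 1)

section LocalGeometry

/-! Local differential geometry of a parametrized submanifold `f : ℝ^n ⊇ U → 𝔼^m_s`, at points
`y` of the open set `U`. -/

variable {n m : ℕ} (s : ℕ) (f : EuclideanSpace ℝ (Fin n) → Fin m → ℝ)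

/-- Components `g_ij = ⟨∂_i f, ∂_j f⟩` of the induced metric. -/
def metricMatrix (y : EuclideanSpace ℝ (Fin n)) : Matrix (Fin n) (Fin n) ℝ :=
  Matrix.of fun i j => pseudoInner s (partialD i f y) (partialD j f y)

/-- Christoffel symbols `Γ^k_ij = ½ ∑_l g^{kl} (∂_i g_jl + ∂_j g_il - ∂_l g_ij)` of the Levi-Civita
connection of the induced metric. -/
def christoffel (k i j : Fin n) (y : EuclideanSpace ℝ (Fin n)) : ℝ :=
  (1 / 2) * ∑ l : Fin n, (metricMatrix s f y)⁻¹ k l *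
    (partialD i (fun z => metricMatrix s f z j l) y
      + partialD j (fun z => metricMatrix s f z i l) y
      - partialD l (fun z => metricMatrix s f z i j) y)

/-- Components of the Riemann curvature tensor of the induced metric:
`R(∂_i, ∂_j) ∂_k = ∑_l (riemann l i j k) ∂_l`. -/
def riemann (l i j k : Fin n) (y : EuclideanSpace ℝ (Fin n)) : ℝ :=
  partialD i (christoffel s f l j k) y - partialD j (christoffel s f l i k) y
    + ∑ p : Fin n, (christoffel s f l i p y * christoffel s f p j k y
      - christoffel s f l j p y * christoffel s f p i k y)

/-- For `f` with values in the unit pseudo-sphere: the covariant derivative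
of the coordinate field `∂_j f` in the direction `∂_i f` with respect to the Levi-Civita connection
of the pseudo-sphere, i.e. the component of `∂_i ∂_j f` tangent to the pseudo-sphere. -/
def sphereCovDeriv (i j : Fin n) (y : EuclideanSpace ℝ (Fin n)) : Fin m → ℝ :=
  partialD i (partialD j f) y - pseudoInner s (partialD i (partialD j f) y) (f y) • f y

/-- Second fundamental form in the unit pseudo-sphere, through the Gauss formula
`h(∂_i, ∂_j) = ∇̃_{∂_i} ∂_j - ∇_{∂_i} ∂_j`. -/
def secondFundForm (i j : Fin n) (y : EuclideanSpace ℝ (Fin n)) : Fin m → ℝ :=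
  sphereCovDeriv s f i j y - ∑ k : Fin n, christoffel s f k i j y • partialD k f y

/-- Mean curvature vector `H = (1/n) tr h` in the unit pseudo-sphere. -/
def meanCurvatureVector (y : EuclideanSpace ℝ (Fin n)) : Fin m → ℝ :=
  (1 / (n : ℝ)) • ∑ i : Fin n, ∑ j : Fin n,
    (metricMatrix s f y)⁻¹ i j • secondFundForm s f i j y

end LocalGeometry

section Surfaces

/-! Surfaces given by a smooth map `x : M → 𝔼^m_s` on a smooth `2`-manifold `M`, which carries the
induced metric. -/

variable {M : Type*} [TopologicalSpace M] [ChartedSpace (EuclideanSpace ℝ (Fin 2)) M]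
  {m : ℕ} (s : ℕ) (x : M → Fin m → ℝ)

/-- The property `P` of local parametrizations at a point holds for `x` in every smooth chart of
`M`, at every point of the chart. -/
def InEveryChart (P : (EuclideanSpace ℝ (Fin 2) → Fin m → ℝ) → EuclideanSpace ℝ (Fin 2) → Prop) :
    Prop :=
  ∀ e ∈ IsManifold.maximalAtlas (𝓡 2) ∞ M, ∀ y ∈ e.target, P (x ∘ e.symm) y

/-- The induced metric is Lorentzian: at each point there is a tangent basis that is orthonormal
with one spacelike and one timelike vector. In particular `x` is an immersion. -/
def IsLorentzianSurface : Prop :=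
  InEveryChart x fun f y => ∃ v w : EuclideanSpace ℝ (Fin 2),
    pseudoInner s (fderiv ℝ f y v) (fderiv ℝ f y v) = 1 ∧
    pseudoInner s (fderiv ℝ f y w) (fderiv ℝ f y w) = -1 ∧
    pseudoInner s (fderiv ℝ f y v) (fderiv ℝ f y w) = 0

/-- The induced metric is flat. -/
def IsFlatSurface : Prop :=
  InEveryChart x fun f y => ∀ l i j k : Fin 2, riemann s f l i j k y = 0

/-- The mean curvature vector field of the surface in the unit pseudo-sphere vanishes. -/
def HasZeroMeanCurvature : Prop :=
  InEveryChart x fun f y => meanCurvatureVector s f y = 0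

end Surfaces

/-- `T` is congruent to an open part of `S` in `𝔼^m_s`: some linear isometry of `𝔼^m_s` (these
leave the pseudo-sphere invariant) maps `T` onto a relatively open subset of `S`. -/
def CongruentToOpenPart {m : ℕ} (s : ℕ) (T S : Set (Fin m → ℝ)) : Prop :=
  ∃ A : (Fin m → ℝ) ≃ₗ[ℝ] (Fin m → ℝ),
    (∀ v w, pseudoInner s (A v) (A w) = pseudoInner s v w) ∧
    ∃ W : Set (Fin m → ℝ), IsOpen W ∧ A '' T = S ∩ W

/-- `(1/√2) (cos u, sin u, cosh v, sinh v)`. -/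
def lorentzCliffordTorus (p : ℝ × ℝ) : Fin 4 → ℝ :=
  (1 / √2) • ![Real.cos p.1, Real.sin p.1, Real.cosh p.2, Real.sinh p.2]

/-- `(cosh u cos v, cosh u sin v, sinh u cos v, sinh u sin v)`. -/
def tensorProductSurface (p : ℝ × ℝ) : Fin 4 → ℝ :=
  ![Real.cosh p.1 * Real.cos p.2, Real.cosh p.1 * Real.sin p.2,
    Real.sinh p.1 * Real.cos p.2, Real.sinh p.1 * Real.sin p.2]

end

/-! Let `n` be a local unit normal of the surface inside the pseudo-sphere, of sign `ε`. The index
forces `ε = 1` for `s = 1` and `ε = -1` for `s = 2`; the other values of `s` leave no room for a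
Lorentzian tangent plane orthogonal to a spacelike position vector. The Weingarten matrix `W` is
trace-free by minimality. The Gauss equation with zero curvature fixes its determinant as `-ε`, so
Cayley–Hamilton gives `W * W = ε • 1` (`weingartenMatrix_mul_self`).

Consequently `n`, regarded as a surface, has metric `ε` times that of `f`, hence the same
Christoffel symbols. The frames `(f, ∂₀f, ∂₁f, n)` and `(n, ∂₀n, ∂₁n, ε f)` therefore solve the same
linear first order system, and a constant linear map `P` carries one to the other
(`exists_linear_normal`). This `P` is self-adjoint with `P² = ε`, and the surface lies in the
quadric `⟨z, z⟩ = 1`, `⟨P z, z⟩ = 0`.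

That quadric is two-dimensional near the surface, so each patch fills an open part of it
(`eventually_mem_image`). A patch determines `P` up to sign (`eq_or_eq_neg`), so connectedness makes
one `P` serve all of `M` (`exists_range_eq_quadric`).

What remains is linear algebra: an orthonormal basis puts `P` in normal form. For `ε = 1` it is an
involution with a definite and a Lorentzian eigenplane, and the quadric consists of two sheets, one
of them the Clifford torus. For `ε = -1` it is a complex structure, and the quadric is the tensor
product surface. -/

open Filter Topology

/-! ### Algebra of the pseudo-Euclidean inner product -/

section PseudoInner

variable {m : ℕ} (s : ℕ)

theorem pseudoInner_comm (x y : Fin m → ℝ) : pseudoInner s x y = pseudoInner s y x := by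
  simp only [pseudoInner, mul_comm]

theorem pseudoInner_add_left (x y z : Fin m → ℝ) :
    pseudoInner s (x + y) z = pseudoInner s x z + pseudoInner s y z := by
  simp only [pseudoInner, Pi.add_apply, ← Finset.sum_add_distrib]
  exact Finset.sum_congr rfl fun i _ => by ring

theorem pseudoInner_smul_left (c : ℝ) (x z : Fin m → ℝ) :
    pseudoInner s (c • x) z = c * pseudoInner s x z := by
  simp only [pseudoInner, Pi.smul_apply, smul_eq_mul, Finset.mul_sum]
  exact Finset.sum_congr rfl fun i _ => by ring

/-- The pseudo-Euclidean inner product as a bilinear form. -/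
noncomputable def pseudoForm : (Fin m → ℝ) →ₗ[ℝ] (Fin m → ℝ) →ₗ[ℝ] ℝ :=
  LinearMap.mk₂ ℝ (pseudoInner s) (pseudoInner_add_left s) (pseudoInner_smul_left s)
    (fun x y z => by
      rw [pseudoInner_comm, pseudoInner_add_left, pseudoInner_comm s y, pseudoInner_comm s z])
    (fun c x y => by
      rw [pseudoInner_comm, pseudoInner_smul_left, pseudoInner_comm, smul_eq_mul])

theorem pseudoForm_apply (x y : Fin m → ℝ) : pseudoForm s x y = pseudoInner s x y := rfl

theorem pseudoInner_add_right (x y z : Fin m → ℝ) :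
    pseudoInner s x (y + z) = pseudoInner s x y + pseudoInner s x z := (pseudoForm s x).map_add y z

theorem pseudoInner_smul_right (c : ℝ) (x y : Fin m → ℝ) :
    pseudoInner s x (c • y) = c * pseudoInner s x y := (pseudoForm s x).map_smul c y

theorem pseudoInner_neg_right (x y : Fin m → ℝ) :
    pseudoInner s x (-y) = -pseudoInner s x y := (pseudoForm s x).map_neg y

theorem pseudoInner_neg_left (x y : Fin m → ℝ) :
    pseudoInner s (-x) y = -pseudoInner s x y := by
  rw [pseudoInner_comm, pseudoInner_neg_right, pseudoInner_comm]

theorem pseudoInner_sub_right (x y z : Fin m → ℝ) :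
    pseudoInner s x (y - z) = pseudoInner s x y - pseudoInner s x z := (pseudoForm s x).map_sub y z

theorem pseudoInner_sub_left (x y z : Fin m → ℝ) :
    pseudoInner s (x - y) z = pseudoInner s x z - pseudoInner s y z := by
  rw [pseudoInner_comm, pseudoInner_sub_right, pseudoInner_comm s z, pseudoInner_comm s z]

theorem pseudoInner_zero_right (x : Fin m → ℝ) : pseudoInner s x 0 = 0 := (pseudoForm s x).map_zero

theorem pseudoInner_zero_left (x : Fin m → ℝ) : pseudoInner s 0 x = 0 := by
  rw [pseudoInner_comm, pseudoInner_zero_right]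

theorem pseudoInner_sum_left {ι : Type*} (t : Finset ι) (F : ι → Fin m → ℝ) (y : Fin m → ℝ) :
    pseudoInner s (∑ i ∈ t, F i) y = ∑ i ∈ t, pseudoInner s (F i) y := by
  simp only [← pseudoForm_apply, map_sum, LinearMap.sum_apply]

theorem pseudoInner_sum_right {ι : Type*} (t : Finset ι) (F : ι → Fin m → ℝ) (y : Fin m → ℝ) :
    pseudoInner s y (∑ i ∈ t, F i) = ∑ i ∈ t, pseudoInner s y (F i) := by
  simp only [← pseudoForm_apply, map_sum]

theorem pseudoInner_nondegenerate {x : Fin m → ℝ} (h : ∀ y, pseudoInner s x y = 0) : x = 0 := by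
  funext i
  have := h (Pi.single i 1)
  simp only [pseudoInner, Pi.single_apply] at this
  rw [Finset.sum_eq_single i] at this
  · rcases ite_eq_or_eq (i.val + s < m) (1 : ℝ) (-1) with h' | h' <;> simpa [h'] using this
  · intro j _ hj
    simp [hj]
  · simp

/-- The pseudo-Euclidean inner product as a continuous bilinear form. -/
noncomputable def pseudoFormL : (Fin m → ℝ) →L[ℝ] (Fin m → ℝ) →L[ℝ] ℝ :=
  (LinearMap.toContinuousLinearMap (𝕜 := ℝ)).toLinearMap.comp (pseudoForm s)
    |>.toContinuousLinearMap

theorem pseudoFormL_apply (x y : Fin m → ℝ) : pseudoFormL s x y = pseudoInner s x y := rfl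

variable {E : Type*} [NormedAddCommGroup E] [NormedSpace ℝ E]

theorem ContDiffAt.pseudoInner {F G : E → Fin m → ℝ} {k : WithTop ℕ∞} {y : E}
    (hF : ContDiffAt ℝ k F y) (hG : ContDiffAt ℝ k G y) :
    ContDiffAt ℝ k (fun z => pseudoInner s (F z) (G z)) y :=
  ((pseudoFormL s).contDiff.contDiffAt.comp y hF).clm_apply hG

end PseudoInner

/-! ### Calculus of partial derivatives and the Koszul formula -/

section PartialD

variable {n m : ℕ} {V : Type*} [NormedAddCommGroup V] [NormedSpace ℝ V]
  {y : EuclideanSpace ℝ (Fin n)}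

theorem partialD_congr {F G : EuclideanSpace ℝ (Fin n) → V} (h : F =ᶠ[𝓝 y] G) (i : Fin n) :
    partialD i F y = partialD i G y := by
  rw [partialD, partialD, h.fderiv_eq]

theorem partialD_const (i : Fin n) (c : V) : partialD i (fun _ => c) y = 0 := by
  simp [partialD]

theorem fderiv_eq_sum_partialD (F : EuclideanSpace ℝ (Fin n) → V)
    (v : EuclideanSpace ℝ (Fin n)) : fderiv ℝ F y v = ∑ i, v i • partialD i F y := by
  simp only [partialD, ← map_smul, ← map_sum]
  congr 1
  ext j
  simp [Finset.sum_apply, Pi.single_apply]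

theorem ContDiffAt.partialD {F : EuclideanSpace ℝ (Fin n) → V} (hF : ContDiffAt ℝ ∞ F y)
    (i : Fin n) : ContDiffAt ℝ ∞ (partialD i F) y :=
  (hF.fderiv_right (m := ∞) le_rfl).clm_apply contDiffAt_const

theorem partialD_comm {F : EuclideanSpace ℝ (Fin n) → V} (hF : ContDiffAt ℝ ∞ F y)
    (i j : Fin n) : partialD i (partialD j F) y = partialD j (partialD i F) y := by
  have hd : DifferentiableAt ℝ (fderiv ℝ F) y :=
    (hF.fderiv_right (m := ∞) le_rfl).differentiableAt (by simp)
  have h (k l : Fin n) : _root_.partialD k (_root_.partialD l F) y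
      = fderiv ℝ (fderiv ℝ F) y (EuclideanSpace.single k 1) (EuclideanSpace.single l 1) := by
    unfold _root_.partialD
    rw [fderiv_clm_apply hd (by fun_prop)]
    simp
  rw [h, h]
  have h2 : ((2 : ℕ∞) : WithTop ℕ∞) ≤ ∞ := mod_cast le_top
  exact (hF.isSymmSndFDerivAt (by simpa using h2)).eq _ _

theorem partialD_pseudoInner (s : ℕ) {F G : EuclideanSpace ℝ (Fin n) → Fin m → ℝ}
    (hF : ContDiffAt ℝ ∞ F y) (hG : ContDiffAt ℝ ∞ G y) (i : Fin n) :
    partialD i (fun z => pseudoInner s (F z) (G z)) y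
      = pseudoInner s (partialD i F y) (G y) + pseudoInner s (F y) (partialD i G y) := by
  have hF' : DifferentiableAt ℝ F y := hF.differentiableAt (by simp)
  have hG' : DifferentiableAt ℝ G y := hG.differentiableAt (by simp)
  have h := (pseudoFormL s).hasFDerivAt_of_bilinear hF'.hasFDerivAt hG'.hasFDerivAt
  have h' : HasFDerivAt (fun z => pseudoInner s (F z) (G z)) _ y := h
  unfold partialD
  rw [h'.fderiv]
  simp [pseudoFormL_apply, add_comm]

theorem partialD_mul {a b : EuclideanSpace ℝ (Fin n) → ℝ}
    (ha : ContDiffAt ℝ ∞ a y) (hb : ContDiffAt ℝ ∞ b y) (i : Fin n) :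
    partialD i (fun z => a z * b z) y = partialD i a y * b y + a y * partialD i b y := by
  unfold partialD
  rw [fderiv_fun_mul (ha.differentiableAt (by simp)) (hb.differentiableAt (by simp))]
  simp
  ring

theorem partialD_sum {ι : Type*} {t : Finset ι} {F : ι → EuclideanSpace ℝ (Fin n) → V}
    (hF : ∀ k ∈ t, ContDiffAt ℝ ∞ (F k) y) (i : Fin n) :
    partialD i (fun z => ∑ k ∈ t, F k z) y = ∑ k ∈ t, partialD i (F k) y := by
  unfold partialD
  rw [fderiv_fun_sum fun k hk => (hF k hk).differentiableAt (by simp)]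
  simp

/-- Koszul formula for coordinate fields. -/
theorem koszul (s : ℕ) {F : EuclideanSpace ℝ (Fin n) → Fin m → ℝ} (hF : ContDiffAt ℝ ∞ F y)
    (i j l : Fin n) :
    partialD i (fun z => metricMatrix s F z j l) y + partialD j (fun z => metricMatrix s F z i l) y
      - partialD l (fun z => metricMatrix s F z i j) y
      = 2 * pseudoInner s (partialD i (partialD j F) y) (partialD l F y) := by
  simp only [metricMatrix, Matrix.of_apply]
  rw [partialD_pseudoInner s (hF.partialD _) (hF.partialD _),
    partialD_pseudoInner s (hF.partialD _) (hF.partialD _),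
    partialD_pseudoInner s (hF.partialD _) (hF.partialD _), partialD_comm hF j i,
    partialD_comm hF l i, partialD_comm hF l j, pseudoInner_comm s (partialD j F y),
    pseudoInner_comm s (partialD i F y)]
  ring

end PartialD

/-! ### Levi-Civita connection of the induced metric and the Gauss equation -/

section GaussEquation

variable {m : ℕ} {s : ℕ} {f : EuclideanSpace ℝ (Fin 2) → Fin m → ℝ}
  {y : EuclideanSpace ℝ (Fin 2)}

theorem metricMatrix_symm {n : ℕ} (s : ℕ) (f : EuclideanSpace ℝ (Fin n) → Fin m → ℝ)
    (y : EuclideanSpace ℝ (Fin n)) (i j : Fin n) :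
    metricMatrix s f y i j = metricMatrix s f y j i := pseudoInner_comm s _ _

theorem ContDiffAt.metricMatrix (s : ℕ) (hf : ContDiffAt ℝ ∞ f y) (i j : Fin 2) :
    ContDiffAt ℝ ∞ (fun z => metricMatrix s f z i j) y :=
  (hf.partialD i).pseudoInner s (hf.partialD j)

theorem ContDiffAt.metricMatrix_det (s : ℕ) (hf : ContDiffAt ℝ ∞ f y) :
    ContDiffAt ℝ ∞ (fun z => (_root_.metricMatrix s f z).det) y := by
  simp only [Matrix.det_fin_two]
  exact ((hf.metricMatrix s 0 0).mul (hf.metricMatrix s 1 1)).sub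
    ((hf.metricMatrix s 0 1).mul (hf.metricMatrix s 1 0))

theorem ContDiffAt.metricMatrix_inv (hf : ContDiffAt ℝ ∞ f y)
    (hg : (_root_.metricMatrix s f y).det ≠ 0) (i j : Fin 2) :
    ContDiffAt ℝ ∞ (fun z => (_root_.metricMatrix s f z)⁻¹ i j) y := by
  simp only [Matrix.inv_def, Ring.inverse_eq_inv', Matrix.smul_apply, smul_eq_mul]
  refine ((hf.metricMatrix_det s).inv hg).mul ?_
  simp only [Matrix.adjugate_fin_two]
  fin_cases i <;> fin_cases j
  · exact hf.metricMatrix s 1 1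
  · exact (hf.metricMatrix s 0 1).neg
  · exact (hf.metricMatrix s 1 0).neg
  · exact hf.metricMatrix s 0 0

theorem ContDiffAt.christoffel (hf : ContDiffAt ℝ ∞ f y)
    (hg : (_root_.metricMatrix s f y).det ≠ 0) (k i j : Fin 2) :
    ContDiffAt ℝ ∞ (_root_.christoffel s f k i j) y := by
  refine contDiffAt_const.mul (ContDiffAt.sum fun l _ => (hf.metricMatrix_inv hg k l).mul ?_)
  exact (((hf.metricMatrix s j l).partialD i).add ((hf.metricMatrix s i l).partialD j)).sub
    ((hf.metricMatrix s i j).partialD l)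

theorem sum_christoffel_mul_metric (hf : ContDiffAt ℝ ∞ f y)
    (hg : (metricMatrix s f y).det ≠ 0) (i j l : Fin 2) :
    ∑ k, christoffel s f k i j y * metricMatrix s f y k l
      = pseudoInner s (partialD i (partialD j f) y) (partialD l f y) := by
  have h1 : (metricMatrix s f y)⁻¹ * metricMatrix s f y = 1 :=
    Matrix.nonsing_inv_mul _ (isUnit_iff_ne_zero.2 hg)
  have hsymm : ((metricMatrix s f y)⁻¹)ᵀ = (metricMatrix s f y)⁻¹ := by
    rw [Matrix.transpose_nonsing_inv]
    congr 1
    ext a b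
    exact metricMatrix_symm s f y b a
  have hinv (a b : Fin 2) : (metricMatrix s f y)⁻¹ a b = (metricMatrix s f y)⁻¹ b a :=
    congrFun (congrFun hsymm b) a
  simp only [christoffel, koszul s hf]
  have h2 (p : Fin 2) : ∑ k, (metricMatrix s f y)⁻¹ p k * metricMatrix s f y k l
      = if p = l then 1 else 0 := by
    rw [← Matrix.mul_apply, h1, Matrix.one_apply]
  calc _ = ∑ p, (∑ k, (metricMatrix s f y)⁻¹ p k * metricMatrix s f y k l) *
        pseudoInner s (partialD i (partialD j f) y) (partialD p f y) := by
        simp only [Fin.sum_univ_two, hinv 1 0]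
        ring
    _ = _ := by simp [h2]

/-- The component of `∂_i ∂_j f` normal to the submanifold. -/
noncomputable def normalPart (s : ℕ) (f : EuclideanSpace ℝ (Fin 2) → Fin m → ℝ) (i j : Fin 2)
    (y : EuclideanSpace ℝ (Fin 2)) : Fin m → ℝ :=
  partialD i (partialD j f) y - ∑ k, christoffel s f k i j y • partialD k f y

theorem pseudoInner_normalPart (hf : ContDiffAt ℝ ∞ f y)
    (hg : (metricMatrix s f y).det ≠ 0) (i j l : Fin 2) :
    pseudoInner s (normalPart s f i j y) (partialD l f y) = 0 := by
  rw [normalPart, pseudoInner_sub_left, ← sum_christoffel_mul_metric hf hg, pseudoInner_sum_left,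
    sub_eq_zero]
  exact Finset.sum_congr rfl fun k _ => by rw [pseudoInner_smul_left]; rfl

theorem pseudoInner_partialD_partialD (hf : ContDiffAt ℝ ∞ f y)
    (hg : (metricMatrix s f y).det ≠ 0) (i j k l : Fin 2) :
    pseudoInner s (partialD i (partialD j f) y) (partialD k (partialD l f) y)
      = pseudoInner s (normalPart s f i j y) (normalPart s f k l y)
        + ∑ p, ∑ q, christoffel s f p i j y * christoffel s f q k l y * metricMatrix s f y p q := by
  have h (i j : Fin 2) : partialD i (partialD j f) y
      = normalPart s f i j y + ∑ k, christoffel s f k i j y • partialD k f y := by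
    simp [normalPart]
  rw [h i j, h k l]
  simp only [pseudoInner_add_left, pseudoInner_add_right, pseudoInner_sum_left,
    pseudoInner_sum_right, pseudoInner_smul_left, pseudoInner_smul_right,
    pseudoInner_normalPart hf hg, pseudoInner_comm s (partialD _ f y) (normalPart s f _ _ y)]
  simp only [Fin.sum_univ_two, metricMatrix, Matrix.of_apply]
  ring

/-- Third derivatives through the curvature of the induced connection. -/
theorem pseudoInner_third_partialD (hfe : ∀ᶠ z in 𝓝 y, ContDiffAt ℝ ∞ f z)
    (hg : (metricMatrix s f y).det ≠ 0) (i j k q : Fin 2) :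
    pseudoInner s (partialD i (partialD j (partialD k f)) y) (partialD q f y)
      = ∑ l, (partialD i (christoffel s f l j k) y
          + ∑ p, christoffel s f l i p y * christoffel s f p j k y) * metricMatrix s f y l q
        - pseudoInner s (normalPart s f j k y) (normalPart s f i q y) := by
  have hf := hfe.self_of_nhds
  have hev : ∀ᶠ z in 𝓝 y, ContDiffAt ℝ ∞ f z ∧ (metricMatrix s f z).det ≠ 0 := by
    refine hfe.and ?_
    exact ((hf.metricMatrix_det s).continuousAt).eventually_ne hg
  -- The third derivative appears on differentiating `⟨∂_j ∂_k f, ∂_q f⟩ = ∑ Γ g`, which is why the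
  -- identity is needed on a whole neighbourhood.
  have h1 : (fun z => ∑ l, christoffel s f l j k z * metricMatrix s f z l q) =ᶠ[𝓝 y]
      fun z => pseudoInner s (partialD j (partialD k f) z) (partialD q f z) := by
    filter_upwards [hev] with z hz
    exact sum_christoffel_mul_metric hz.1 hz.2 j k q
  have h2 := partialD_congr h1 i
  rw [partialD_sum (fun l _ => (hf.christoffel hg l j k).mul (hf.metricMatrix s l q)),
    partialD_pseudoInner s ((hf.partialD k).partialD j) (hf.partialD q),
    pseudoInner_partialD_partialD hf hg] at h2
  have h3 (l : Fin 2) : partialD i (fun z => metricMatrix s f z l q) y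
      = ∑ p, christoffel s f p i l y * metricMatrix s f y p q
        + ∑ p, christoffel s f p i q y * metricMatrix s f y p l := by
    rw [sum_christoffel_mul_metric hf hg, sum_christoffel_mul_metric hf hg,
      pseudoInner_comm s (partialD i (partialD q f) y)]
    exact partialD_pseudoInner s (hf.partialD l) (hf.partialD q) i
  have h4 (l : Fin 2) : partialD i (fun z => christoffel s f l j k z * metricMatrix s f z l q) y
      = _ := partialD_mul (hf.christoffel hg l j k) (hf.metricMatrix s l q) i
  simp only [h4, h3] at h2
  rw [eq_sub_iff_add_eq, ← sub_eq_zero]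
  rw [← sub_eq_zero] at h2
  simp only [Fin.sum_univ_two, metricMatrix_symm s f y 1 0] at h2 ⊢
  linear_combination -h2

/-- The Gauss equation. -/
theorem gauss_equation (hfe : ∀ᶠ z in 𝓝 y, ContDiffAt ℝ ∞ f z)
    (hg : (metricMatrix s f y).det ≠ 0) (i j k q : Fin 2) :
    ∑ l, riemann s f l i j k y * metricMatrix s f y l q
      = pseudoInner s (normalPart s f j k y) (normalPart s f i q y)
        - pseudoInner s (normalPart s f i k y) (normalPart s f j q y) := by
  have hf := hfe.self_of_nhds
  have h1 := pseudoInner_third_partialD hfe hg i j k q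
  have h2 := pseudoInner_third_partialD hfe hg j i k q
  -- Third derivatives are symmetric in `i, j`, so antisymmetrizing leaves only the curvature and
  -- the normal terms.
  rw [partialD_comm (hf.partialD k) j i, h1] at h2
  simp only [riemann, Fin.sum_univ_two] at h2 ⊢
  linear_combination h2

end GaussEquation

/-! ### Uniqueness for linear first order systems of frames -/

section FrameTransport

variable {n m : ℕ}

/-- The linear map sending the standard basis to the vectors `F a`. -/
noncomputable def frameMap (F : Fin m → Fin m → ℝ) : (Fin m → ℝ) →L[ℝ] (Fin m → ℝ) :=
  ∑ a, (ContinuousLinearMap.proj (R := ℝ) (φ := fun _ : Fin m => ℝ) a).smulRight (F a)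

theorem frameMap_apply (F : Fin m → Fin m → ℝ) (c : Fin m → ℝ) :
    frameMap F c = ∑ a, c a • F a := by
  simp [frameMap]

theorem frameMap_single (F : Fin m → Fin m → ℝ) (a : Fin m) :
    frameMap F (Pi.single a 1) = F a := by
  simp [frameMap_apply, Pi.single_apply]

theorem differentiableAt_frameMap {F : Fin m → EuclideanSpace ℝ (Fin n) → Fin m → ℝ}
    {y : EuclideanSpace ℝ (Fin n)} (hF : ∀ a, DifferentiableAt ℝ (F a) y) :
    DifferentiableAt ℝ (fun z => frameMap fun a => F a z) y := by
  unfold frameMap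
  refine DifferentiableAt.fun_sum fun a _ => ?_
  exact ((ContinuousLinearMap.smulRightL ℝ (Fin m → ℝ) (Fin m → ℝ)
    (ContinuousLinearMap.proj (R := ℝ) (φ := fun _ : Fin m => ℝ) a)).differentiableAt).comp y (hF a)

theorem exists_equiv_frameMap {F : Fin m → Fin m → ℝ} (hF : LinearIndependent ℝ F) :
    ∃ e : (Fin m → ℝ) ≃L[ℝ] (Fin m → ℝ), (e : (Fin m → ℝ) →L[ℝ] (Fin m → ℝ)) = frameMap F := by
  have hinj : Function.Injective (frameMap F : (Fin m → ℝ) →ₗ[ℝ] (Fin m → ℝ)) := by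
    rw [← LinearMap.ker_eq_bot, LinearMap.ker_eq_bot']
    intro c hc
    funext a
    exact Fintype.linearIndependent_iff.1 hF c (by rw [← frameMap_apply]; exact hc) a
  refine ⟨(LinearEquiv.ofInjectiveEndo _ hinj).toContinuousLinearEquiv, ?_⟩
  ext c
  rfl

/-- Two frames that satisfy the same linear first order system differ by a constant linear map. -/
theorem exists_frame_transport {U : Set (EuclideanSpace ℝ (Fin n))} (hU : IsOpen U)
    (hc : IsPreconnected U) {F G : Fin m → EuclideanSpace ℝ (Fin n) → Fin m → ℝ}
    (hF : ∀ y ∈ U, ∀ a, DifferentiableAt ℝ (F a) y)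
    (hG : ∀ y ∈ U, ∀ a, DifferentiableAt ℝ (G a) y)
    (hli : ∀ y ∈ U, LinearIndependent ℝ fun a => F a y)
    (hFG : ∀ y ∈ U, ∀ j a, ∃ w : Fin m → ℝ, partialD j (F a) y = ∑ b, w b • F b y ∧
      partialD j (G a) y = ∑ b, w b • G b y) :
    ∃ P : (Fin m → ℝ) →L[ℝ] (Fin m → ℝ), ∀ y ∈ U, ∀ a, P (F a y) = G a y := by
  -- Pointwise change of frame `G ∘ F⁻¹`. The default value of `inverse` plays no role, since the
  -- frame `F` is invertible on `U`.
  let P : EuclideanSpace ℝ (Fin n) → (Fin m → ℝ) →L[ℝ] (Fin m → ℝ) := fun y =>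
    (frameMap fun a => G a y).comp (ContinuousLinearMap.inverse (frameMap fun a => F a y))
  have hPF : ∀ y ∈ U, ∀ a, P y (F a y) = G a y := by
    intro y hy a
    obtain ⟨e, he⟩ := exists_equiv_frameMap (hli y hy)
    have h1 : F a y = e (Pi.single a 1) := by
      rw [← frameMap_single (fun a => F a y) a, ← he]
      rfl
    simp only [P, ← he, ContinuousLinearMap.inverse_equiv, h1]
    simp [frameMap_single]
  have hPd : ∀ y ∈ U, DifferentiableAt ℝ P y := by
    intro y hy
    obtain ⟨e, he⟩ := exists_equiv_frameMap (hli y hy)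
    refine (differentiableAt_frameMap (hG y hy)).clm_comp ?_
    have h := (contDiffAt_map_inverse (𝕜 := ℝ) (n := 1) e).differentiableAt (by simp)
    rw [he] at h
    exact DifferentiableAt.comp y h (differentiableAt_frameMap (hF y hy))
  -- Differentiating `P F_a = G_a` gives `(∂P) F_a + P (∂F_a) = ∂G_a`. The common coefficients make
  -- the last two terms equal, so `∂P` kills the basis `F`.
  have hP0 : ∀ y ∈ U, fderiv ℝ P y = 0 := by
    intro y hy
    have hj (j : Fin n) : partialD j P y = 0 := by
      obtain ⟨e, he⟩ := exists_equiv_frameMap (hli y hy)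
      have h1 (a : Fin m) : partialD j P y (F a y) = 0 := by
        obtain ⟨w, h2, h3⟩ := hFG y hy j a
        have h4 : (fun z => P z (F a z)) =ᶠ[𝓝 y] G a := by
          filter_upwards [hU.mem_nhds hy] with z hz using hPF z hz a
        have h5 := partialD_congr h4 j
        unfold partialD at h5 h2 h3 ⊢
        rw [fderiv_clm_apply (hPd y hy) (hF y hy a)] at h5
        simp only [add_apply, ContinuousLinearMap.comp_apply,
          ContinuousLinearMap.flip_apply, h2, h3, map_sum, map_smul, hPF y hy] at h5
        simpa using h5
      ext1 c
      obtain ⟨d, rfl⟩ := e.surjective c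
      have h6 : e d = ∑ a, d a • F a y := by
        rw [← frameMap_apply (fun a => F a y), ← he]
        rfl
      simp [h6, h1]
    ext1 v
    rw [fderiv_eq_sum_partialD]
    simp [hj]
  rcases U.eq_empty_or_nonempty with rfl | ⟨y₀, hy₀⟩
  · exact ⟨0, by simp⟩
  · refine ⟨P y₀, fun y hy a => ?_⟩
    rw [hU.is_const_of_fderiv_eq_zero hc (fun z hz => (hPd z hz).differentiableWithinAt)
      hP0 hy₀ hy]
    exact hPF y hy a

end FrameTransport

/-! ### Triple cross product in four dimensions -/

section CrossProduct

/-- The sign of the normal of a Lorentzian surface in `𝕊^3_s`, for `s = 1` and `s = 2`. -/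
def IsNormalSign (s : ℕ) (ε : ℝ) : Prop := s = 1 ∧ ε = 1 ∨ s = 2 ∧ ε = -1

theorem IsNormalSign.mul_self {s : ℕ} {ε : ℝ} (h : IsNormalSign s ε) : ε * ε = 1 := by
  rcases h with ⟨-, rfl⟩ | ⟨-, rfl⟩ <;> norm_num

theorem pseudoInner_one (x y : Fin 4 → ℝ) :
    pseudoInner 1 x y = x 0 * y 0 + x 1 * y 1 + x 2 * y 2 - x 3 * y 3 := by
  simp [pseudoInner, Fin.sum_univ_four]
  ring

theorem pseudoInner_two (x y : Fin 4 → ℝ) :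
    pseudoInner 2 x y = x 0 * y 0 + x 1 * y 1 - x 2 * y 2 - x 3 * y 3 := by
  simp [pseudoInner, Fin.sum_univ_four]
  ring

/-- The determinant of the rows `a, b, c` of coordinates of `u, v, w`. -/
def minorDet (u v w : Fin 4 → ℝ) (a b c : Fin 4) : ℝ :=
  u a * (v b * w c - v c * w b) - u b * (v a * w c - v c * w a) + u c * (v a * w b - v b * w a)

/-- The triple cross product of `𝔼^4_s`. -/
def tripleCross (s : ℕ) (u v w : Fin 4 → ℝ) : Fin 4 → ℝ := fun i =>
  (if i.val + s < 4 then (1 : ℝ) else -1) *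
    ![minorDet u v w 1 2 3, -minorDet u v w 0 2 3, minorDet u v w 0 1 3, -minorDet u v w 0 1 2] i

theorem pseudoInner_tripleCross (s : ℕ) (u v w z : Fin 4 → ℝ) :
    pseudoInner s (tripleCross s u v w) z = z 0 * minorDet u v w 1 2 3 - z 1 * minorDet u v w 0 2 3
      + z 2 * minorDet u v w 0 1 3 - z 3 * minorDet u v w 0 1 2 := by
  have h (i : Fin 4) : (if i.val + s < 4 then (1 : ℝ) else -1) *
      (if i.val + s < 4 then (1 : ℝ) else -1) = 1 := by split_ifs <;> norm_num
  simp only [pseudoInner, tripleCross, mul_assoc]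
  simp only [← mul_assoc, h]
  simp [Fin.sum_univ_four]
  ring

theorem pseudoInner_tripleCross_fst (s : ℕ) (u v w : Fin 4 → ℝ) :
    pseudoInner s (tripleCross s u v w) u = 0 := by
  rw [pseudoInner_tripleCross]; unfold minorDet; ring

theorem pseudoInner_tripleCross_snd (s : ℕ) (u v w : Fin 4 → ℝ) :
    pseudoInner s (tripleCross s u v w) v = 0 := by
  rw [pseudoInner_tripleCross]; unfold minorDet; ring

theorem pseudoInner_tripleCross_trd (s : ℕ) (u v w : Fin 4 → ℝ) :
    pseudoInner s (tripleCross s u v w) w = 0 := by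
  rw [pseudoInner_tripleCross]; unfold minorDet; ring

/-- The square of a triple cross product is the Gram determinant times the sign `(-1)^s` of the
ambient form, which equals `-ε` in both cases. The hypotheses on `u` reduce the Gram determinant to
a 2 by 2 one. -/
theorem pseudoInner_tripleCross_self {s : ℕ} {ε : ℝ} (h : IsNormalSign s ε)
    {u v w : Fin 4 → ℝ} (huu : pseudoInner s u u = 1) (huv : pseudoInner s u v = 0)
    (huw : pseudoInner s u w = 0) :
    pseudoInner s (tripleCross s u v w) (tripleCross s u v w) = -ε *
      (pseudoInner s v v * pseudoInner s w w - pseudoInner s v w * pseudoInner s v w) := by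
  have key : pseudoInner s (tripleCross s u v w) (tripleCross s u v w) = -ε *
      (pseudoInner s u u *
        (pseudoInner s v v * pseudoInner s w w - pseudoInner s v w * pseudoInner s v w)
      - pseudoInner s u v *
        (pseudoInner s u v * pseudoInner s w w - pseudoInner s v w * pseudoInner s u w)
      + pseudoInner s u w *
        (pseudoInner s u v * pseudoInner s v w - pseudoInner s v v * pseudoInner s u w)) := by
    rw [pseudoInner_tripleCross]
    rcases h with ⟨rfl, rfl⟩ | ⟨rfl, rfl⟩
    · simp [pseudoInner_one, tripleCross]
      unfold minorDet
      ring
    · simp [pseudoInner_two, tripleCross]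
      unfold minorDet
      ring
  rw [key, huu, huv, huw]
  ring

theorem ContDiffAt.tripleCross {E : Type*} [NormedAddCommGroup E] [NormedSpace ℝ E] (s : ℕ)
    {u v w : E → Fin 4 → ℝ} {k : WithTop ℕ∞} {y : E} (hu : ContDiffAt ℝ k u y)
    (hv : ContDiffAt ℝ k v y) (hw : ContDiffAt ℝ k w y) :
    ContDiffAt ℝ k (fun z => tripleCross s (u z) (v z) (w z)) y := by
  have hu' := contDiffAt_pi.1 hu
  have hv' := contDiffAt_pi.1 hv
  have hw' := contDiffAt_pi.1 hw
  have hm (a b c : Fin 4) : ContDiffAt ℝ k (fun z => minorDet (u z) (v z) (w z) a b c) y := by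
    unfold minorDet
    fun_prop
  rw [contDiffAt_pi]
  intro i
  unfold _root_.tripleCross
  refine contDiffAt_const.mul ?_
  fin_cases i
  · exact hm 1 2 3
  · exact (hm 0 2 3).neg
  · exact hm 0 1 3
  · exact (hm 0 1 2).neg

end CrossProduct

/-! ### Cayley–Hamilton for trace-free 2 by 2 matrices -/

section Matrices

theorem Matrix.mul_self_of_trace_eq_zero {T : Matrix (Fin 2) (Fin 2) ℝ} (h : T.trace = 0) :
    T * T = -T.det • (1 : Matrix (Fin 2) (Fin 2) ℝ) := by
  rw [Matrix.trace_fin_two] at h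
  ext i j
  fin_cases i <;> fin_cases j <;>
    simp only [Matrix.mul_apply, Fin.sum_univ_two, Matrix.det_fin_two, Matrix.smul_apply,
      Matrix.one_apply, smul_eq_mul, Fin.zero_eta, Fin.mk_one, Fin.isValue, if_true,
      zero_ne_one, one_ne_zero, if_false]
  · linear_combination T 0 0 * h
  · linear_combination T 0 1 * h
  · linear_combination T 1 0 * h
  · linear_combination T 1 1 * h

end Matrices

/-! ### Frames adapted to the surface -/

section AdaptedFrame

variable {s : ℕ} {ε : ℝ} {e n : Fin 4 → ℝ} {t : Fin 2 → Fin 4 → ℝ}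

/-- The vectors `e, t 0, t 1, n` consist of a spacelike unit vector, a basis of a nondegenerate
plane with Gram matrix `g`, and a normal of sign `ε`. -/
structure IsAdaptedFrame (s : ℕ) (ε : ℝ) (e n : Fin 4 → ℝ) (t : Fin 2 → Fin 4 → ℝ) : Prop where
  ee : pseudoInner s e e = 1
  en : pseudoInner s e n = 0
  nn : pseudoInner s n n = ε
  et : ∀ i, pseudoInner s e (t i) = 0
  nt : ∀ i, pseudoInner s n (t i) = 0
  det : (Matrix.of fun i j => pseudoInner s (t i) (t j)).det ≠ 0
  sign : ε * ε = 1

namespace IsAdaptedFrame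

theorem linearIndependent (h : IsAdaptedFrame s ε e n t) :
    LinearIndependent ℝ ![e, t 0, t 1, n] := by
  rw [Fintype.linearIndependent_iff]
  intro c hc
  simp only [Fin.sum_univ_four] at hc
  have hB (z : Fin 4 → ℝ) : c 0 * pseudoInner s e z + c 1 * pseudoInner s (t 0) z
      + c 2 * pseudoInner s (t 1) z + c 3 * pseudoInner s n z = 0 := by
    have := congrArg (fun x => pseudoInner s x z) hc
    simpa [pseudoInner_add_left, pseudoInner_smul_left, pseudoInner_zero_left] using this
  have he := hB e
  have hn := hB n
  have h0 := hB (t 0)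
  have h1 := hB (t 1)
  have hdet := h.det
  have hs := h.sign
  rw [Matrix.det_fin_two] at hdet
  simp only [Matrix.of_apply] at hdet
  simp only [h.ee, h.en, h.et, h.nn, h.nt, pseudoInner_comm s (t _) e, pseudoInner_comm s n e,
    pseudoInner_comm s (t _) n] at he hn h0 h1
  have e0 : c 0 = 0 := by linear_combination he
  have e3 : c 3 = 0 := by linear_combination ε * hn - c 3 * hs
  -- Cramer's rule for the Gram system of `t 0, t 1`.
  have e1 : c 1 = 0 := by
    refine (mul_eq_zero.1 ?_).resolve_right hdet
    linear_combination pseudoInner s (t 1) (t 1) * h0 - pseudoInner s (t 1) (t 0) * h1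
  have e2 : c 2 = 0 := by
    refine (mul_eq_zero.1 ?_).resolve_right hdet
    linear_combination pseudoInner s (t 0) (t 0) * h1 - pseudoInner s (t 0) (t 1) * h0
  intro i
  fin_cases i
  exacts [e0, e1, e2, e3]

/-- The basis given by an adapted frame. -/
noncomputable def basis (h : IsAdaptedFrame s ε e n t) : Module.Basis (Fin 4) ℝ (Fin 4 → ℝ) :=
  basisOfLinearIndependentOfCardEqFinrank h.linearIndependent (by simp)

theorem basis_apply (h : IsAdaptedFrame s ε e n t) (a : Fin 4) :
    h.basis a = ![e, t 0, t 1, n] a := by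
  simp [basis]

theorem linearMap_ext {W : Type*} [AddCommGroup W] [Module ℝ W] (h : IsAdaptedFrame s ε e n t)
    {A B : (Fin 4 → ℝ) →ₗ[ℝ] W} (he : A e = B e) (hn : A n = B n) (ht : ∀ i, A (t i) = B (t i)) :
    A = B := by
  refine h.basis.ext fun a => ?_
  rw [h.basis_apply]
  fin_cases a
  exacts [he, ht 0, ht 1, hn]

theorem ext (h : IsAdaptedFrame s ε e n t) {z z' : Fin 4 → ℝ}
    (he : pseudoInner s z e = pseudoInner s z' e) (hn : pseudoInner s z n = pseudoInner s z' n)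
    (ht : ∀ i, pseudoInner s z (t i) = pseudoInner s z' (t i)) : z = z' := by
  have key : pseudoForm s z = pseudoForm s z' := h.linearMap_ext he hn ht
  rw [← sub_eq_zero]
  refine pseudoInner_nondegenerate s fun x => ?_
  rw [pseudoInner_sub_left, sub_eq_zero]
  exact LinearMap.congr_fun key x

end IsAdaptedFrame

end AdaptedFrame

/-! ### Structure equations of a flat minimal patch -/

section Patch

variable {s : ℕ} {ε : ℝ} {U : Set (EuclideanSpace ℝ (Fin 2))}
  {f n : EuclideanSpace ℝ (Fin 2) → Fin 4 → ℝ} {y : EuclideanSpace ℝ (Fin 2)}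

/-- A parametrized flat minimal Lorentzian surface in the unit pseudo-sphere. -/
structure IsFlatMinimalPatch (s : ℕ) (U : Set (EuclideanSpace ℝ (Fin 2)))
    (f : EuclideanSpace ℝ (Fin 2) → Fin 4 → ℝ) : Prop where
  isOpen : IsOpen U
  smooth : ∀ y ∈ U, ContDiffAt ℝ ∞ f y
  unit : ∀ y ∈ U, pseudoInner s (f y) (f y) = 1
  lorentz : ∀ y ∈ U, ∃ v w : EuclideanSpace ℝ (Fin 2),
    pseudoInner s (fderiv ℝ f y v) (fderiv ℝ f y v) = 1 ∧
    pseudoInner s (fderiv ℝ f y w) (fderiv ℝ f y w) = -1 ∧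
    pseudoInner s (fderiv ℝ f y v) (fderiv ℝ f y w) = 0
  flat : ∀ y ∈ U, ∀ l i j k : Fin 2, riemann s f l i j k y = 0
  mean : ∀ y ∈ U, meanCurvatureVector s f y = 0

/-- A unit normal field of sign `ε` along a parametrized surface in the unit pseudo-sphere. -/
structure IsUnitNormal (s : ℕ) (ε : ℝ) (U : Set (EuclideanSpace ℝ (Fin 2)))
    (f n : EuclideanSpace ℝ (Fin 2) → Fin 4 → ℝ) : Prop where
  smooth : ∀ y ∈ U, ContDiffAt ℝ ∞ n y
  sign : ε * ε = 1
  unit : ∀ y ∈ U, pseudoInner s (n y) (n y) = ε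
  position : ∀ y ∈ U, pseudoInner s (n y) (f y) = 0
  tangent : ∀ y ∈ U, ∀ i, pseudoInner s (n y) (partialD i f y) = 0

theorem partialD_eq_zero_of_eqOn_const {φ : EuclideanSpace ℝ (Fin 2) → ℝ} {c : ℝ} (hU : IsOpen U)
    (hφ : ∀ z ∈ U, φ z = c) (hy : y ∈ U) (i : Fin 2) : partialD i φ y = 0 := by
  have h : φ =ᶠ[𝓝 y] fun _ => c := by
    filter_upwards [hU.mem_nhds hy] with z hz using hφ z hz
  rw [partialD_congr h, partialD_const]

theorem pseudoInner_fderiv (s : ℕ) (f : EuclideanSpace ℝ (Fin 2) → Fin 4 → ℝ)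
    (v w : EuclideanSpace ℝ (Fin 2)) :
    pseudoInner s (fderiv ℝ f y v) (fderiv ℝ f y w)
      = ∑ i, ∑ j, v i * w j * metricMatrix s f y i j := by
  rw [fderiv_eq_sum_partialD, fderiv_eq_sum_partialD]
  simp only [pseudoInner_add_left, pseudoInner_add_right, pseudoInner_smul_left,
    pseudoInner_smul_right, metricMatrix, Matrix.of_apply, Fin.sum_univ_two]
  ring

namespace IsFlatMinimalPatch

/-- The Gram determinant of the Lorentzian basis `v, w` is `-1`, and it is the determinant of the
metric times the square of a change of basis determinant. -/
theorem det_neg (h : IsFlatMinimalPatch s U f) (hy : y ∈ U) : (metricMatrix s f y).det < 0 := by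
  obtain ⟨v, w, hv, hw, hvw⟩ := h.lorentz y hy
  rw [pseudoInner_fderiv] at hv hw hvw
  simp only [Fin.sum_univ_two, metricMatrix_symm s f y 1 0] at hv hw hvw
  have key : (v 0 * w 1 - v 1 * w 0) ^ 2 * (metricMatrix s f y).det = -1 := by
    rw [Matrix.det_fin_two, metricMatrix_symm s f y 1 0]
    have h1 : (v 0 * v 0 * metricMatrix s f y 0 0 + v 0 * v 1 * metricMatrix s f y 0 1 +
        (v 1 * v 0 * metricMatrix s f y 0 1 + v 1 * v 1 * metricMatrix s f y 1 1)) *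
        (w 0 * w 0 * metricMatrix s f y 0 0 + w 0 * w 1 * metricMatrix s f y 0 1 +
        (w 1 * w 0 * metricMatrix s f y 0 1 + w 1 * w 1 * metricMatrix s f y 1 1)) -
        (v 0 * w 0 * metricMatrix s f y 0 0 + v 0 * w 1 * metricMatrix s f y 0 1 +
        (v 1 * w 0 * metricMatrix s f y 0 1 + v 1 * w 1 * metricMatrix s f y 1 1)) ^ 2 = -1 := by
      rw [hv, hw, hvw]; norm_num
    linear_combination h1
  by_contra hcon
  have := mul_nonneg (sq_nonneg (v 0 * w 1 - v 1 * w 0)) (not_lt.1 hcon)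
  linarith

theorem position_tangent (h : IsFlatMinimalPatch s U f) (hy : y ∈ U) (i : Fin 2) :
    pseudoInner s (f y) (partialD i f y) = 0 := by
  have h1 := partialD_eq_zero_of_eqOn_const h.isOpen h.unit hy i
  rw [partialD_pseudoInner s (h.smooth y hy) (h.smooth y hy),
    pseudoInner_comm s (partialD i f y)] at h1
  linarith

/-- The cross product of `f, ∂₀f, ∂₁f` has square `-ε det g`. As `det g < 0`, division by `√(-det
g)` is smooth and leaves a normal of square `ε`. -/
theorem exists_unitNormal (h : IsFlatMinimalPatch s U f) (hε : IsNormalSign s ε) :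
    ∃ n, IsUnitNormal s ε U f n := by
  have hdet {y} (hy : y ∈ U) : 0 < -(metricMatrix s f y).det := neg_pos.2 (h.det_neg hy)
  refine ⟨fun y => (√(-(metricMatrix s f y).det))⁻¹ •
    tripleCross s (f y) (partialD 0 f y) (partialD 1 f y), ⟨fun y hy => ?_, hε.mul_self,
    fun y hy => ?_, fun y hy => ?_, fun y hy i => ?_⟩⟩
  · have hs := h.smooth y hy
    have h1 : ContDiffAt ℝ ∞ (fun z => (√(-(metricMatrix s f z).det))⁻¹) y :=
      (((hs.metricMatrix_det s).neg).sqrt (hdet hy).ne').inv (Real.sqrt_pos.2 (hdet hy)).ne'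
    exact h1.smul (hs.tripleCross s (hs.partialD 0) (hs.partialD 1))
  · rw [pseudoInner_smul_left, pseudoInner_smul_right, pseudoInner_tripleCross_self hε (h.unit y hy)
      (h.position_tangent hy 0) (h.position_tangent hy 1), ← mul_assoc, ← mul_inv,
      Real.mul_self_sqrt (hdet hy).le]
    have h1 : (metricMatrix s f y).det
        = pseudoInner s (partialD 0 f y) (partialD 0 f y) *
          pseudoInner s (partialD 1 f y) (partialD 1 f y) -
          pseudoInner s (partialD 0 f y) (partialD 1 f y) *
          pseudoInner s (partialD 0 f y) (partialD 1 f y) := by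
      rw [Matrix.det_fin_two, metricMatrix_symm s f y 1 0]
      rfl
    rw [← h1]
    have := (h.det_neg hy).ne
    field_simp
  · rw [pseudoInner_smul_left, pseudoInner_tripleCross_fst, mul_zero]
  · rw [pseudoInner_smul_left]
    fin_cases i
    · simp [pseudoInner_tripleCross_snd]
    · simp [pseudoInner_tripleCross_trd]

theorem isAdaptedFrame (h : IsFlatMinimalPatch s U f) (hn : IsUnitNormal s ε U f n) (hy : y ∈ U) :
    IsAdaptedFrame s ε (f y) (n y) (fun i => partialD i f y) where
  ee := h.unit y hy
  en := by rw [pseudoInner_comm]; exact hn.position y hy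
  nn := hn.unit y hy
  et := h.position_tangent hy
  nt := hn.tangent y hy
  det := (h.det_neg hy).ne
  sign := hn.sign

end IsFlatMinimalPatch

/-- The coefficients of the second fundamental form with respect to the normal field `n`. -/
noncomputable def secondFundMatrix (s : ℕ) (ε : ℝ)
    (f n : EuclideanSpace ℝ (Fin 2) → Fin 4 → ℝ) (y : EuclideanSpace ℝ (Fin 2)) :
    Matrix (Fin 2) (Fin 2) ℝ :=
  Matrix.of fun i j => ε * pseudoInner s (n y) (partialD i (partialD j f) y)

/-- The coefficients of the differential of the normal field. -/
noncomputable def weingartenMatrix (s : ℕ) (ε : ℝ)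
    (f n : EuclideanSpace ℝ (Fin 2) → Fin 4 → ℝ) (y : EuclideanSpace ℝ (Fin 2)) :
    Matrix (Fin 2) (Fin 2) ℝ :=
  -ε • (secondFundMatrix s ε f n y * (metricMatrix s f y)⁻¹)

namespace IsFlatMinimalPatch

theorem secondFundMatrix_symm (h : IsFlatMinimalPatch s U f) (hy : y ∈ U) (i j : Fin 2) :
    secondFundMatrix s ε f n y i j = secondFundMatrix s ε f n y j i := by
  simp only [secondFundMatrix, Matrix.of_apply, partialD_comm (h.smooth y hy) i j]

theorem pseudoInner_partialD_partialD_position (h : IsFlatMinimalPatch s U f) (hy : y ∈ U)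
    (i j : Fin 2) : pseudoInner s (partialD i (partialD j f) y) (f y) = -metricMatrix s f y i j := by
  have hs := h.smooth y hy
  have h1 := partialD_eq_zero_of_eqOn_const h.isOpen (fun z hz => h.position_tangent hz j) hy i
  rw [partialD_pseudoInner s hs (hs.partialD j), pseudoInner_comm s (f y)] at h1
  have h2 : metricMatrix s f y i j = pseudoInner s (partialD i f y) (partialD j f y) := rfl
  linarith

theorem pseudoInner_partialD_normal (h : IsFlatMinimalPatch s U f) (hn : IsUnitNormal s ε U f n)
    (hy : y ∈ U) (i j : Fin 2) :
    pseudoInner s (partialD i n y) (partialD j f y) = -ε * secondFundMatrix s ε f n y i j := by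
  have hs := h.smooth y hy
  have h1 := partialD_eq_zero_of_eqOn_const h.isOpen (fun z hz => hn.tangent z hz j) hy i
  rw [partialD_pseudoInner s (hn.smooth y hy) (hs.partialD j)] at h1
  simp only [secondFundMatrix, Matrix.of_apply]
  linear_combination h1 + pseudoInner s (n y) (partialD i (partialD j f) y) * hn.sign

theorem pseudoInner_partialD_normal_position (h : IsFlatMinimalPatch s U f)
    (hn : IsUnitNormal s ε U f n) (hy : y ∈ U) (i : Fin 2) :
    pseudoInner s (partialD i n y) (f y) = 0 := by
  have h1 := partialD_eq_zero_of_eqOn_const h.isOpen hn.position hy i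
  rwa [partialD_pseudoInner s (hn.smooth y hy) (h.smooth y hy), hn.tangent y hy, add_zero] at h1

theorem pseudoInner_partialD_normal_normal (h : IsFlatMinimalPatch s U f)
    (hn : IsUnitNormal s ε U f n) (hy : y ∈ U) (i : Fin 2) :
    pseudoInner s (partialD i n y) (n y) = 0 := by
  have h1 := partialD_eq_zero_of_eqOn_const h.isOpen hn.unit hy i
  rw [partialD_pseudoInner s (hn.smooth y hy) (hn.smooth y hy),
    pseudoInner_comm s (n y)] at h1
  linarith

/-- Gauss formula. -/
theorem normalPart_eq (h : IsFlatMinimalPatch s U f) (hn : IsUnitNormal s ε U f n)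
    (hy : y ∈ U) (i j : Fin 2) : normalPart s f i j y
      = secondFundMatrix s ε f n y i j • n y - metricMatrix s f y i j • f y := by
  have ha := h.isAdaptedFrame hn hy
  have het (k : Fin 2) : pseudoInner s (partialD k f y) (f y) = 0 := by
    rw [pseudoInner_comm]; exact ha.et k
  have hnt (k : Fin 2) : pseudoInner s (partialD k f y) (n y) = 0 := by
    rw [pseudoInner_comm]; exact ha.nt k
  refine ha.ext ?_ ?_ fun k => ?_
  · simp [normalPart, pseudoInner_sub_left, pseudoInner_add_left, pseudoInner_smul_left, het,
      h.pseudoInner_partialD_partialD_position hy, ha.ee, hn.position y hy]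
  · simp only [normalPart, pseudoInner_sub_left, pseudoInner_sum_left, pseudoInner_smul_left, hnt,
      ha.nn, ha.en, secondFundMatrix, Matrix.of_apply, mul_zero, Finset.sum_const_zero,
      pseudoInner_comm s (partialD i (partialD j f) y)]
    linear_combination -pseudoInner s (n y) (partialD i (partialD j f) y) * hn.sign
  · rw [pseudoInner_normalPart (h.smooth y hy) (h.det_neg hy).ne]
    simp [pseudoInner_sub_left, pseudoInner_smul_left, hn.tangent y hy, h.position_tangent hy]

theorem partialD_partialD_eq (h : IsFlatMinimalPatch s U f) (hn : IsUnitNormal s ε U f n)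
    (hy : y ∈ U) (i j : Fin 2) : partialD i (partialD j f) y
      = ∑ k, christoffel s f k i j y • partialD k f y
        + secondFundMatrix s ε f n y i j • n y - metricMatrix s f y i j • f y := by
  have h1 := h.normalPart_eq hn hy i j
  rw [normalPart, sub_eq_iff_eq_add] at h1
  rw [h1]
  abel

/-- The Gauss equation with zero curvature reads `0 = ε det b + det g`, where `b` is the second
fundamental matrix. The term `det g` is the curvature of the unit pseudo-sphere and comes from the
component `-g_ij f` of the normal part. -/
theorem det_secondFundMatrix (h : IsFlatMinimalPatch s U f) (hn : IsUnitNormal s ε U f n)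
    (hy : y ∈ U) : (secondFundMatrix s ε f n y).det = -ε * (metricMatrix s f y).det := by
  have hfe : ∀ᶠ z in 𝓝 y, ContDiffAt ℝ ∞ f z := by
    filter_upwards [h.isOpen.mem_nhds hy] with z hz using h.smooth z hz
  have h1 := gauss_equation (s := s) hfe (h.det_neg hy).ne 0 1 1 0
  have ha := h.isAdaptedFrame hn hy
  simp only [h.flat y hy, zero_mul, Finset.sum_const_zero, h.normalPart_eq hn hy,
    pseudoInner_sub_left, pseudoInner_sub_right, pseudoInner_smul_left, pseudoInner_smul_right,
    ha.ee, ha.en, ha.nn, hn.position y hy] at h1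
  rw [Matrix.det_fin_two, Matrix.det_fin_two]
  linear_combination -ε * h1 - (secondFundMatrix s ε f n y 0 0 * secondFundMatrix s ε f n y 1 1
    - secondFundMatrix s ε f n y 0 1 * secondFundMatrix s ε f n y 1 0) * hn.sign

theorem secondFundForm_eq (h : IsFlatMinimalPatch s U f) (hn : IsUnitNormal s ε U f n)
    (hy : y ∈ U) (i j : Fin 2) :
    secondFundForm s f i j y = secondFundMatrix s ε f n y i j • n y := by
  rw [secondFundForm, sphereCovDeriv, h.pseudoInner_partialD_partialD_position hy,
    h.partialD_partialD_eq hn hy, neg_smul]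
  abel

theorem trace_secondFundMatrix (h : IsFlatMinimalPatch s U f) (hn : IsUnitNormal s ε U f n)
    (hy : y ∈ U) : ((metricMatrix s f y)⁻¹ * secondFundMatrix s ε f n y).trace = 0 := by
  have h1 := congrArg (fun z => pseudoInner s z (n y)) (h.mean y hy)
  have ha := h.isAdaptedFrame hn hy
  simp only [meanCurvatureVector, h.secondFundForm_eq hn hy, pseudoInner_smul_left,
    pseudoInner_sum_left, ha.nn, pseudoInner_zero_left] at h1
  simp only [Matrix.trace_fin_two, Matrix.mul_apply, Fin.sum_univ_two] at h1 ⊢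
  rw [h.secondFundMatrix_symm hy 1 0] at h1 ⊢
  push_cast at h1
  linear_combination 2 * ε * h1 - ((metricMatrix s f y)⁻¹ 0 0 * secondFundMatrix s ε f n y 0 0 +
    (metricMatrix s f y)⁻¹ 0 1 * secondFundMatrix s ε f n y 0 1 +
    ((metricMatrix s f y)⁻¹ 1 0 * secondFundMatrix s ε f n y 0 1 +
    (metricMatrix s f y)⁻¹ 1 1 * secondFundMatrix s ε f n y 1 1)) * hn.sign

theorem trace_weingartenMatrix (h : IsFlatMinimalPatch s U f) (hn : IsUnitNormal s ε U f n)
    (hy : y ∈ U) : (weingartenMatrix s ε f n y).trace = 0 := by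
  rw [weingartenMatrix, Matrix.trace_smul, Matrix.trace_mul_comm, h.trace_secondFundMatrix hn hy,
    smul_zero]

theorem weingartenMatrix_mul_metric (h : IsFlatMinimalPatch s U f) (hy : y ∈ U) :
    weingartenMatrix s ε f n y * metricMatrix s f y = -ε • secondFundMatrix s ε f n y := by
  rw [weingartenMatrix, Matrix.smul_mul, Matrix.mul_assoc,
    Matrix.nonsing_inv_mul _ (isUnit_iff_ne_zero.2 (h.det_neg hy).ne), Matrix.mul_one]

/-- Taking determinants in `W g = -ε b` with `det b = -ε det g` yields `det W = -ε`; with zero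
trace, Cayley–Hamilton concludes. -/
theorem weingartenMatrix_mul_self (h : IsFlatMinimalPatch s U f) (hn : IsUnitNormal s ε U f n)
    (hy : y ∈ U) : weingartenMatrix s ε f n y * weingartenMatrix s ε f n y = ε • 1 := by
  rw [Matrix.mul_self_of_trace_eq_zero (h.trace_weingartenMatrix hn hy)]
  congr 1
  have h1 := congrArg Matrix.det (h.weingartenMatrix_mul_metric (ε := ε) (n := n) hy)
  rw [Matrix.det_mul, Matrix.det_smul, h.det_secondFundMatrix hn hy, Fintype.card_fin] at h1
  refine mul_right_cancel₀ (h.det_neg hy).ne ?_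
  linear_combination -h1 + (metricMatrix s f y).det * ε * hn.sign

/-- Weingarten formula. -/
theorem partialD_normal_eq (h : IsFlatMinimalPatch s U f) (hn : IsUnitNormal s ε U f n)
    (hy : y ∈ U) (i : Fin 2) :
    partialD i n y = ∑ k, weingartenMatrix s ε f n y i k • partialD k f y := by
  have ha := h.isAdaptedFrame hn hy
  refine ha.ext ?_ ?_ fun j => ?_
  · simp [pseudoInner_add_left, pseudoInner_smul_left, pseudoInner_comm s (partialD _ f y) (f y),
      h.position_tangent hy, h.pseudoInner_partialD_normal_position hn hy]
  · simp [pseudoInner_add_left, pseudoInner_smul_left, pseudoInner_comm s (partialD _ f y) (n y),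
      hn.tangent y hy, h.pseudoInner_partialD_normal_normal hn hy]
  · rw [h.pseudoInner_partialD_normal hn hy, pseudoInner_sum_left]
    have h1 := congrFun (congrFun (h.weingartenMatrix_mul_metric (ε := ε) (n := n) hy) i) j
    rw [Matrix.mul_apply, Matrix.smul_apply, smul_eq_mul] at h1
    rw [← h1]
    exact Finset.sum_congr rfl fun k _ => by rw [pseudoInner_smul_left]; rfl

/-- Since `∂n = W ∂f` and `W² = ε`, also `W ∂n = ε ∂f`: the roles of `f` and `n` are interchangeable
up to `ε`. -/
theorem sum_weingartenMatrix_smul (h : IsFlatMinimalPatch s U f) (hn : IsUnitNormal s ε U f n)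
    (hy : y ∈ U) (i : Fin 2) :
    ∑ k, weingartenMatrix s ε f n y i k • partialD k n y = ε • partialD i f y := by
  have h1 (j : Fin 2) := congrFun (congrFun (h.weingartenMatrix_mul_self hn hy) i) j
  simp only [Matrix.mul_apply, Matrix.smul_apply, smul_eq_mul, Fin.sum_univ_two] at h1
  simp only [h.partialD_normal_eq hn hy, Fin.sum_univ_two, smul_add, smul_smul]
  have h2 : ε • partialD i f y = (ε * (1 : Matrix (Fin 2) (Fin 2) ℝ) i 0) • partialD 0 f y
      + (ε * (1 : Matrix (Fin 2) (Fin 2) ℝ) i 1) • partialD 1 f y := by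
    revert i
    simp [Fin.forall_fin_two]
  rw [h2, ← h1, ← h1]
  module

/-- The normal field, seen as a surface, has the metric of `f` multiplied by `ε`. -/
theorem metricMatrix_normal (h : IsFlatMinimalPatch s U f) (hn : IsUnitNormal s ε U f n)
    (hy : y ∈ U) (i j : Fin 2) : metricMatrix s n y i j = ε * metricMatrix s f y i j := by
  -- `-ε b = W g`, so the left side is `W² g`.
  have h0 : weingartenMatrix s ε f n y * -ε • secondFundMatrix s ε f n y
      = ε • metricMatrix s f y := by
    rw [← h.weingartenMatrix_mul_metric hy, ← Matrix.mul_assoc, h.weingartenMatrix_mul_self hn hy,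
      Matrix.smul_mul, Matrix.one_mul]
  have h1 := congrFun (congrFun h0 i) j
  simp only [Matrix.mul_apply, Matrix.smul_apply, smul_eq_mul, Fin.sum_univ_two] at h1
  rw [← h1]
  change pseudoInner s (partialD i n y) (partialD j n y) = _
  rw [h.partialD_normal_eq hn hy i, pseudoInner_sum_left]
  simp only [pseudoInner_smul_left, pseudoInner_comm s (partialD _ f y),
    h.pseudoInner_partialD_normal hn hy, Fin.sum_univ_two, h.secondFundMatrix_symm hy j]

/-- This is the Gauss formula for `f` with `f, n` replaced by `n, ε f` and all coefficients
unchanged. The Christoffel symbols agree because the metrics of `f` and `n` differ by the constant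
`ε`; this takes the place of the Codazzi equation. -/
theorem partialD_partialD_normal_eq (h : IsFlatMinimalPatch s U f) (hn : IsUnitNormal s ε U f n)
    (hy : y ∈ U) (i j : Fin 2) : partialD i (partialD j n) y
      = ∑ k, christoffel s f k i j y • partialD k n y
        + secondFundMatrix s ε f n y i j • ε • f y - metricMatrix s f y i j • n y := by
  have ha := h.isAdaptedFrame hn hy
  have hs := h.smooth y hy
  have hns := hn.smooth y hy
  have hfn (k : Fin 2) : pseudoInner s (f y) (partialD k n y) = 0 := by
    rw [pseudoInner_comm, h.pseudoInner_partialD_normal_position hn hy]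
  have hnn (k : Fin 2) : pseudoInner s (n y) (partialD k n y) = 0 := by
    rw [pseudoInner_comm, h.pseudoInner_partialD_normal_normal hn hy]
  -- Both sides are compared through the Koszul formula, applied to `n` and to `f`, whose metric
  -- terms differ by the factor `ε`.
  have key (l : Fin 2) : pseudoInner s (partialD i (partialD j n) y) (partialD l n y)
      = pseudoInner s (∑ k, christoffel s f k i j y • partialD k n y
        + secondFundMatrix s ε f n y i j • ε • f y - metricMatrix s f y i j • n y)
        (partialD l n y) := by
    have hm (l a b : Fin 2) : partialD l (fun z => metricMatrix s n z a b) y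
        = ε * partialD l (fun z => metricMatrix s f z a b) y := by
      have : (fun z => metricMatrix s n z a b) =ᶠ[𝓝 y] fun z => ε * metricMatrix s f z a b := by
        filter_upwards [h.isOpen.mem_nhds hy] with z hz using h.metricMatrix_normal hn hz a b
      rw [partialD_congr this, partialD_mul contDiffAt_const (hs.metricMatrix s a b),
        partialD_const]
      ring
    have h1 := koszul s hns i j l
    have h2 := koszul s hs i j l
    rw [← sum_christoffel_mul_metric hs (h.det_neg hy).ne] at h2
    simp only [hm] at h1
    simp only [pseudoInner_sub_left, pseudoInner_add_left, pseudoInner_smul_left,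
      pseudoInner_sum_left, hfn, hnn, mul_zero, add_zero, sub_zero]
    have h3 (k : Fin 2) : pseudoInner s (partialD k n y) (partialD l n y)
        = ε * metricMatrix s f y k l := h.metricMatrix_normal hn hy k l
    simp only [h3]
    simp only [Fin.sum_univ_two] at h2 ⊢
    linear_combination -h1 / 2 + ε / 2 * h2
  refine ha.ext ?_ ?_ fun l => ?_
  · have h1 := partialD_eq_zero_of_eqOn_const h.isOpen
      (fun z hz => h.pseudoInner_partialD_normal_position hn hz j) hy i
    rw [partialD_pseudoInner s (hns.partialD j) hs, h.pseudoInner_partialD_normal hn hy,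
      h.secondFundMatrix_symm hy] at h1
    simp only [pseudoInner_sub_left, pseudoInner_add_left, pseudoInner_smul_left,
      pseudoInner_sum_left, h.pseudoInner_partialD_normal_position hn hy, ha.ee,
      hn.position y hy, mul_zero, Finset.sum_const_zero]
    linear_combination h1
  · have h1 := partialD_eq_zero_of_eqOn_const h.isOpen
      (fun z hz => h.pseudoInner_partialD_normal_normal hn hz j) hy i
    have h2 : pseudoInner s (partialD j n y) (partialD i n y) = ε * metricMatrix s f y j i :=
      h.metricMatrix_normal hn hy j i
    rw [partialD_pseudoInner s (hns.partialD j) hns, h2, metricMatrix_symm] at h1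
    simp only [pseudoInner_sub_left, pseudoInner_add_left, pseudoInner_smul_left,
      pseudoInner_sum_left, h.pseudoInner_partialD_normal_normal hn hy, ha.nn, ha.en,
      mul_zero, Finset.sum_const_zero]
    linear_combination h1
  -- The vectors `∂f` are combinations of the `∂n`, so testing against `∂n` suffices.
  · have h1 : partialD l f y = ε • ∑ k, weingartenMatrix s ε f n y l k • partialD k n y := by
      rw [h.sum_weingartenMatrix_smul hn hy, smul_smul, hn.sign, one_smul]
    simp only [h1, pseudoInner_smul_right, pseudoInner_sum_right, key]

end IsFlatMinimalPatch

end Patch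

/-! ### The constant operator `P` with `P f = n` -/

section QuadricOperator

variable {s : ℕ} {ε : ℝ} {U : Set (EuclideanSpace ℝ (Fin 2))}
  {f n : EuclideanSpace ℝ (Fin 2) → Fin 4 → ℝ} {y : EuclideanSpace ℝ (Fin 2)}

/-- A self-adjoint operator of `𝔼^4_s` with square `ε`. -/
structure IsSelfAdjointRoot (s : ℕ) (ε : ℝ) (P : (Fin 4 → ℝ) →L[ℝ] (Fin 4 → ℝ)) : Prop where
  selfAdjoint : ∀ z z', pseudoInner s (P z) z' = pseudoInner s z (P z')
  sq : ∀ z, P (P z) = ε • z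

/-- An orthonormal basis of the tangent plane at `x` to the quadric
`⟨z, z⟩ = 1`, `⟨P z, z⟩ = 0`, for which `P` has the same diagonal values on both vectors. -/
structure IsTangentFrame (s : ℕ) (P : (Fin 4 → ℝ) →L[ℝ] (Fin 4 → ℝ)) (x v w : Fin 4 → ℝ) :
    Prop where
  vv : pseudoInner s v v = 1
  ww : pseudoInner s w w = -1
  vw : pseudoInner s v w = 0
  xv : pseudoInner s x v = 0
  xw : pseudoInner s x w = 0
  nv : pseudoInner s (P x) v = 0
  nw : pseudoInner s (P x) w = 0
  diag : pseudoInner s (P v) v = pseudoInner s (P w) w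

namespace IsFlatMinimalPatch

/-- The unit normal field is a constant linear map applied to the position vector. -/
theorem exists_linear_normal (h : IsFlatMinimalPatch s U f) (hn : IsUnitNormal s ε U f n)
    (hU : IsPreconnected U) : ∃ P : (Fin 4 → ℝ) →L[ℝ] (Fin 4 → ℝ), ∀ z ∈ U,
      P (f z) = n z ∧ (∀ i, P (partialD i f z) = partialD i n z) ∧ P (n z) = ε • f z := by
  have hd {W : Type} [NormedAddCommGroup W] [NormedSpace ℝ W] {φ : EuclideanSpace ℝ (Fin 2) → W}
      {z : EuclideanSpace ℝ (Fin 2)} (hφ : ContDiffAt ℝ ∞ φ z) : DifferentiableAt ℝ φ z :=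
    hφ.differentiableAt (by simp)
  have hεf {z} (hz : z ∈ U) : ContDiffAt ℝ ∞ (fun u => ε • f u) z :=
    (h.smooth z hz).const_smul ε
  suffices key : ∃ P : (Fin 4 → ℝ) →L[ℝ] (Fin 4 → ℝ), ∀ z ∈ U, ∀ a,
      P (![f, partialD 0 f, partialD 1 f, n] a z)
        = ![n, partialD 0 n, partialD 1 n, fun z => ε • f z] a z by
    obtain ⟨P, hP⟩ := key
    refine ⟨P, fun z hz => ⟨hP z hz 0, fun i => ?_, hP z hz 3⟩⟩
    fin_cases i
    · exact hP z hz 1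
    · exact hP z hz 2
  refine exists_frame_transport h.isOpen hU ?_ ?_ ?_ ?_
  · intro z hz a
    have hs := h.smooth z hz
    fin_cases a
    exacts [hd hs, hd (hs.partialD 0), hd (hs.partialD 1), hd (hn.smooth z hz)]
  · intro z hz a
    have hs := hn.smooth z hz
    fin_cases a
    exacts [hd hs, hd (hs.partialD 0), hd (hs.partialD 1), hd (hεf hz)]
  · intro z hz
    convert (h.isAdaptedFrame hn hz).linearIndependent using 1
    funext a
    fin_cases a <;> rfl
  · intro z hz j a
    have tangent (i : Fin 2) : ∃ w : Fin 4 → ℝ,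
        partialD j (partialD i f) z = ∑ b, w b • ![f, partialD 0 f, partialD 1 f, n] b z ∧
        partialD j (partialD i n) z
          = ∑ b, w b • ![n, partialD 0 n, partialD 1 n, fun z => ε • f z] b z := by
      -- One coefficient vector serves both frames: the two Gauss formulas have the same
      -- coefficients.
      refine ⟨![-metricMatrix s f z j i, christoffel s f 0 j i z, christoffel s f 1 j i z,
        secondFundMatrix s ε f n z j i], ?_, ?_⟩
      · rw [h.partialD_partialD_eq hn hz]
        simp [Fin.sum_univ_four, Fin.sum_univ_two]
        module
      · rw [h.partialD_partialD_normal_eq hn hz]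
        simp [Fin.sum_univ_four, Fin.sum_univ_two]
        module
    fin_cases a
    · refine ⟨![0, if j = 0 then 1 else 0, if j = 1 then 1 else 0, 0], ?_⟩
      fin_cases j <;> simp [Fin.sum_univ_four]
    · exact tangent 0
    · exact tangent 1
    · refine ⟨![0, weingartenMatrix s ε f n z j 0, weingartenMatrix s ε f n z j 1, 0], ?_, ?_⟩
      · refine (h.partialD_normal_eq hn hz j).trans ?_
        simp [Fin.sum_univ_four, Fin.sum_univ_two]
      · have h1 : partialD j (fun z => ε • f z) z = ε • partialD j f z := by
          unfold partialD
          rw [fderiv_fun_const_smul (hd (h.smooth z hz))]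
          rfl
        refine h1.trans ?_
        rw [← h.sum_weingartenMatrix_smul hn hz]
        simp [Fin.sum_univ_four, Fin.sum_univ_two]

/-- Both properties are checked on the adapted frame. Self-adjointness on tangent vectors is the
symmetry of the second fundamental form; `P² = ε` on them is `W² = ε`. -/
theorem isSelfAdjointRoot (h : IsFlatMinimalPatch s U f) (hn : IsUnitNormal s ε U f n)
    {P : (Fin 4 → ℝ) →L[ℝ] (Fin 4 → ℝ)} (hy : y ∈ U) (hf : P (f y) = n y)
    (ht : ∀ i, P (partialD i f y) = partialD i n y) (hPn : P (n y) = ε • f y) :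
    IsSelfAdjointRoot s ε P := by
  have ha := h.isAdaptedFrame hn hy
  have hne : pseudoInner s (n y) (f y) = 0 := hn.position y hy
  constructor
  · have h1 : (pseudoForm s).comp (P : (Fin 4 → ℝ) →ₗ[ℝ] (Fin 4 → ℝ))
        = (pseudoForm s).compl₂ (P : (Fin 4 → ℝ) →ₗ[ℝ] (Fin 4 → ℝ)) := by
      refine ha.linearMap_ext (ha.linearMap_ext ?_ ?_ fun j => ?_)
        (ha.linearMap_ext ?_ ?_ fun j => ?_) fun i => ha.linearMap_ext ?_ ?_ fun j => ?_
      all_goals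
        simp only [LinearMap.comp_apply, LinearMap.compl₂_apply, ContinuousLinearMap.coe_coe,
          pseudoForm_apply, hf, ht, hPn, pseudoInner_smul_left, pseudoInner_smul_right, ha.en,
          hne, ha.nn, ha.ee, ha.et, ha.nt, mul_zero, mul_one,
          h.pseudoInner_partialD_normal hn hy, h.pseudoInner_partialD_normal_position hn hy,
          h.pseudoInner_partialD_normal_normal hn hy,
          pseudoInner_comm s (f y) (partialD _ n y), pseudoInner_comm s (n y) (partialD _ n y),
          pseudoInner_comm s (partialD _ f y) (f y), pseudoInner_comm s (partialD _ f y) (n y)]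
      rw [pseudoInner_comm, h.pseudoInner_partialD_normal hn hy, h.secondFundMatrix_symm hy]
    intro z z'
    exact LinearMap.congr_fun (LinearMap.congr_fun h1 z) z'
  · have h1 : (P : (Fin 4 → ℝ) →ₗ[ℝ] (Fin 4 → ℝ)).comp (P : (Fin 4 → ℝ) →ₗ[ℝ] (Fin 4 → ℝ))
        = ε • LinearMap.id := by
      refine ha.linearMap_ext ?_ ?_ fun i => ?_
      · simp [hf, hPn]
      · simp [hf, hPn]
      · simp only [LinearMap.comp_apply, ContinuousLinearMap.coe_coe, ht, LinearMap.smul_apply,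
          LinearMap.id_apply]
        rw [h.partialD_normal_eq hn hy, map_sum, ← h.sum_weingartenMatrix_smul hn hy]
        simp [ht]
    intro z
    exact LinearMap.congr_fun h1 z

/-- In a Lorentzian orthonormal basis the trace of a form is its value on `v` minus its value on
`w`, and minimality makes this trace vanish. -/
theorem secondFundMatrix_diag (h : IsFlatMinimalPatch s U f) (hn : IsUnitNormal s ε U f n)
    (hy : y ∈ U) {v w : EuclideanSpace ℝ (Fin 2)}
    (hv : pseudoInner s (fderiv ℝ f y v) (fderiv ℝ f y v) = 1)
    (hw : pseudoInner s (fderiv ℝ f y w) (fderiv ℝ f y w) = -1)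
    (hvw : pseudoInner s (fderiv ℝ f y v) (fderiv ℝ f y w) = 0) :
    ∑ i, ∑ j, v i * v j * secondFundMatrix s ε f n y i j
      = ∑ i, ∑ j, w i * w j * secondFundMatrix s ε f n y i j := by
  rw [pseudoInner_fderiv] at hv hw hvw
  simp only [Fin.sum_univ_two, metricMatrix_symm s f y 1 0] at hv hw hvw
  let E : Matrix (Fin 2) (Fin 2) ℝ := !![v 0, v 1; w 0, w 1]
  let T : Matrix (Fin 2) (Fin 2) ℝ := !![v 0, w 0; v 1, w 1]
  let D : Matrix (Fin 2) (Fin 2) ℝ := !![1, 0; 0, -1]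
  have hg : metricMatrix s f y = !![metricMatrix s f y 0 0, metricMatrix s f y 0 1;
      metricMatrix s f y 0 1, metricMatrix s f y 1 1] := by
    have := Matrix.eta_fin_two (metricMatrix s f y)
    rwa [metricMatrix_symm s f y 1 0] at this
  -- Orthonormality says `E g T = D` with `D² = 1`; this exhibits `g⁻¹ = T D E`.
  have h1 : (D * E) * (metricMatrix s f y * T) = 1 := by
    rw [hg]
    ext i j
    fin_cases i <;> fin_cases j <;>
      simp [D, E, T, Matrix.mul_apply, Fin.sum_univ_two]
    · linear_combination hv
    · linear_combination hvw
    · linear_combination -hvw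
    · linear_combination -hw
  have h2 : (metricMatrix s f y)⁻¹ = T * (D * E) := by
    refine Matrix.inv_eq_right_inv ?_
    rw [← Matrix.mul_assoc]
    exact mul_eq_one_comm.1 h1
  have h3 := h.trace_secondFundMatrix hn hy
  rw [h2] at h3
  simp only [D, E, T, Matrix.trace_fin_two, Matrix.mul_apply, Fin.sum_univ_two,
    h.secondFundMatrix_symm hy 1 0, Matrix.of_apply, Matrix.cons_val_zero,
    Matrix.cons_val_one] at h3 ⊢
  linear_combination h3

theorem exists_selfAdjointRoot (h : IsFlatMinimalPatch s U f) (hε : IsNormalSign s ε)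
    (hy : y ∈ U) : ∃ P, IsSelfAdjointRoot s ε P ∧
      (∀ᶠ z in 𝓝 y, pseudoInner s (P (f z)) (f z) = 0) ∧
      ∃ v w, IsTangentFrame s P (f y) v w := by
  -- Frame transport requires a connected domain, and the chart domain need not be one; a ball is.
  obtain ⟨r, hr, hrU⟩ := Metric.isOpen_iff.1 h.isOpen y hy
  have h' : IsFlatMinimalPatch s (Metric.ball y r) f :=
    ⟨Metric.isOpen_ball, fun z hz => h.smooth z (hrU hz), fun z hz => h.unit z (hrU hz),
      fun z hz => h.lorentz z (hrU hz), fun z hz => h.flat z (hrU hz),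
      fun z hz => h.mean z (hrU hz)⟩
  obtain ⟨n, hn⟩ := h'.exists_unitNormal hε
  have hyr := Metric.mem_ball_self (x := y) hr
  obtain ⟨P, hP⟩ := h'.exists_linear_normal hn (convex_ball y r).isPreconnected
  obtain ⟨v, w, hv, hw, hvw⟩ := h.lorentz y hy
  have hPd (u : EuclideanSpace ℝ (Fin 2)) :
      pseudoInner s (P (fderiv ℝ f y u)) (fderiv ℝ f y u)
        = -ε * ∑ i, ∑ j, u i * u j * secondFundMatrix s ε f n y i j := by
    rw [fderiv_eq_sum_partialD]
    simp only [Fin.sum_univ_two, map_add, map_smul, (hP y hyr).2.1, pseudoInner_add_left,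
      pseudoInner_add_right, pseudoInner_smul_left, pseudoInner_smul_right,
      h'.pseudoInner_partialD_normal hn hyr]
    ring
  have hfd (u : EuclideanSpace ℝ (Fin 2)) : pseudoInner s (f y) (fderiv ℝ f y u) = 0 := by
    simp [fderiv_eq_sum_partialD, pseudoInner_add_right, pseudoInner_smul_right,
      h.position_tangent hy]
  have hnd (u : EuclideanSpace ℝ (Fin 2)) : pseudoInner s (n y) (fderiv ℝ f y u) = 0 := by
    simp [fderiv_eq_sum_partialD, pseudoInner_add_right, pseudoInner_smul_right,
      hn.tangent y hyr]
  refine ⟨P, h'.isSelfAdjointRoot hn hyr (hP y hyr).1 (hP y hyr).2.1 (hP y hyr).2.2, ?_,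
    fderiv ℝ f y v, fderiv ℝ f y w, hv, hw, hvw, hfd v, hfd w, ?_, ?_, ?_⟩
  · filter_upwards [Metric.ball_mem_nhds y hr] with z hz
    rw [(hP z hz).1]
    exact hn.position z hz
  · rw [(hP y hyr).1, hnd]
  · rw [(hP y hyr).1, hnd]
  · rw [hPd, hPd, h'.secondFundMatrix_diag hn hyr hv hw hvw]

end IsFlatMinimalPatch

end QuadricOperator

/-! ### Uniqueness of the quadric and openness of a patch in it -/

section Rigidity

variable {s : ℕ} {ε : ℝ} {U : Set (EuclideanSpace ℝ (Fin 2))}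
  {f : EuclideanSpace ℝ (Fin 2) → Fin 4 → ℝ} {y : EuclideanSpace ℝ (Fin 2)}
  {P P' : (Fin 4 → ℝ) →L[ℝ] (Fin 4 → ℝ)}

theorem partialD_clm_apply (P : (Fin 4 → ℝ) →L[ℝ] (Fin 4 → ℝ)) (hf : ContDiffAt ℝ ∞ f y)
    (i : Fin 2) : partialD i (fun z => P (f z)) y = P (partialD i f y) := by
  unfold partialD
  have h : HasFDerivAt (fun z => P (f z)) (P.comp (fderiv ℝ f y)) y :=
    P.hasFDerivAt.comp y (hf.differentiableAt (by simp)).hasFDerivAt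
  rw [h.fderiv]
  rfl

theorem IsSelfAdjointRoot.neg (hP : IsSelfAdjointRoot s ε P) : IsSelfAdjointRoot s ε (-P) := by
  constructor
  · intro z z'
    simp [pseudoInner_neg_left, pseudoInner_neg_right, hP.selfAdjoint z z']
  · intro z
    simp [hP.sq z]

namespace IsFlatMinimalPatch

theorem mono (h : IsFlatMinimalPatch s U f) {V : Set (EuclideanSpace ℝ (Fin 2))} (hV : IsOpen V)
    (hVU : V ⊆ U) : IsFlatMinimalPatch s V f :=
  ⟨hV, fun z hz => h.smooth z (hVU hz), fun z hz => h.unit z (hVU hz),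
    fun z hz => h.lorentz z (hVU hz), fun z hz => h.flat z (hVU hz), fun z hz => h.mean z (hVU hz)⟩

/-- The normality of `P f` follows by differentiating `⟨P f, f⟩ = 0` with `P` self-adjoint; its
square is `⟨P² f, f⟩ = ε`. -/
theorem isUnitNormal_of_quadric (h : IsFlatMinimalPatch s U f) (hε : ε * ε = 1)
    (hP : IsSelfAdjointRoot s ε P) (hq : ∀ z ∈ U, pseudoInner s (P (f z)) (f z) = 0) :
    IsUnitNormal s ε U f fun z => P (f z) where
  smooth y hy := P.contDiff.contDiffAt.comp y (h.smooth y hy)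
  sign := hε
  unit y hy := by
    rw [← hP.selfAdjoint, hP.sq, pseudoInner_smul_left, h.unit y hy, mul_one]
  position := hq
  tangent y hy i := by
    have hs := h.smooth y hy
    have h1 := partialD_eq_zero_of_eqOn_const h.isOpen hq hy i
    have hPs : ContDiffAt ℝ ∞ (fun z => P (f z)) y := P.contDiff.contDiffAt.comp y hs
    rw [partialD_pseudoInner s hPs hs, partialD_clm_apply P hs,
      hP.selfAdjoint, pseudoInner_comm s (partialD i f y)] at h1
    linarith

/-- The quadric containing a patch determines its operator up to sign. -/
theorem eq_or_eq_neg (h : IsFlatMinimalPatch s U f) (hε : ε * ε = 1) (hy : y ∈ U)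
    (hP : IsSelfAdjointRoot s ε P) (hP' : IsSelfAdjointRoot s ε P')
    (hq : ∀ᶠ z in 𝓝 y, pseudoInner s (P (f z)) (f z) = 0)
    (hq' : ∀ᶠ z in 𝓝 y, pseudoInner s (P' (f z)) (f z) = 0) : P = P' ∨ P = -P' := by
  obtain ⟨V, hV, hVo, hyV⟩ := eventually_nhds_iff.1
    ((hq.and hq').and (h.isOpen.mem_nhds hy))
  have h' := h.mono hVo fun z hz => (hV z hz).2
  have hn := h'.isUnitNormal_of_quadric hε hP fun z hz => (hV z hz).1.1
  have hn' := h'.isUnitNormal_of_quadric hε hP' fun z hz => (hV z hz).1.2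
  -- `P f` and `P' f` are unit normals in the same normal line, so they differ by a factor `c` with
  -- `c² = 1`, constant near `y` by continuity.
  let c : EuclideanSpace ℝ (Fin 2) → ℝ := fun z => ε * pseudoInner s (P (f z)) (P' (f z))
  have hc : ∀ z ∈ V, P (f z) = c z • P' (f z) := by
    intro z hz
    refine (h'.isAdaptedFrame hn' hz).ext ?_ ?_ fun i => ?_
    · rw [pseudoInner_smul_left, hn.position z hz, hn'.position z hz, mul_zero]
    · rw [pseudoInner_smul_left, hn'.unit z hz]
      linear_combination -pseudoInner s (P (f z)) (P' (f z)) * hε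
    · rw [pseudoInner_smul_left, hn.tangent z hz, hn'.tangent z hz, mul_zero]
  have hcc : ∀ z ∈ V, c z * c z = 1 := by
    intro z hz
    have h1 := hn.unit z hz
    simp only [hc z hz, pseudoInner_smul_left, pseudoInner_smul_right, hn'.unit z hz] at h1
    linear_combination ε * h1 - (c z * c z - 1) * hε
  have hcont : ContinuousAt c y :=
    (contDiffAt_const.mul ((hn.smooth y hyV).pseudoInner s (hn'.smooth y hyV))).continuousAt
  have hconst : ∀ᶠ z in 𝓝 y, c z = c y := by
    have h1 : ∀ᶠ z in 𝓝 y, 0 < c z * c y := by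
      have h2 : ContinuousAt (fun z => c z * c y) y := hcont.mul continuousAt_const
      exact h2.eventually_const_lt (one_pos.trans_eq (hcc y hyV).symm)
    filter_upwards [h1, hVo.mem_nhds hyV] with z hz hzV
    have e1 := hcc z hzV
    have e2 := hcc y hyV
    have e3 : (c z - c y) * (c z + c y) = 0 := by linear_combination e1 - e2
    rcases mul_eq_zero.1 e3 with e4 | e4
    · linarith
    · rw [eq_neg_of_add_eq_zero_left e4] at hz
      nlinarith
  have hPf : P (f y) = c y • P' (f y) := hc y hyV
  have hs := h.smooth y hy
  have hPt (i : Fin 2) : P (partialD i f y) = c y • P' (partialD i f y) := by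
    have h1 : (fun z => P (f z)) =ᶠ[𝓝 y] fun z => (c y • P') (f z) := by
      filter_upwards [hconst, hVo.mem_nhds hyV] with z hz hzV
      rw [hc z hzV, hz]
      rfl
    have h2 := partialD_congr h1 i
    rwa [partialD_clm_apply P hs, partialD_clm_apply (c y • P') hs] at h2
  -- On the normal vector the claim follows from `P' f = c P f` and `P² = P'² = ε`, without
  -- differentiation.
  have hPn : P (P' (f y)) = c y • P' (P' (f y)) := by
    have h1 : P' (f y) = c y • P (f y) := by rw [hPf, smul_smul, hcc y hyV, one_smul]
    rw [hP'.sq]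
    conv_lhs => rw [h1]
    rw [map_smul, hP.sq]
  have key : P = c y • P' := by
    have := (h'.isAdaptedFrame hn' hyV).linearMap_ext
      (A := (P : (Fin 4 → ℝ) →ₗ[ℝ] (Fin 4 → ℝ)))
      (B := ((c y • P' : (Fin 4 → ℝ) →L[ℝ] (Fin 4 → ℝ)) : (Fin 4 → ℝ) →ₗ[ℝ] (Fin 4 → ℝ)))
      hPf hPn hPt
    exact ContinuousLinearMap.coe_injective this
  rcases mul_self_eq_one_iff.1 (hcc y hyV) with h1 | h1
  · left; rw [key, h1, one_smul]
  · right; rw [key, h1]; exact neg_one_smul ℝ P'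

/-- A patch contained in the quadric of `P` fills a neighbourhood in that quadric. -/
theorem eventually_mem_image (h : IsFlatMinimalPatch s U f) (hε : ε * ε = 1) (hy : y ∈ U)
    (hP : IsSelfAdjointRoot s ε P) (hq : ∀ z ∈ U, pseudoInner s (P (f z)) (f z) = 0) :
    ∀ᶠ z in 𝓝 (f y), pseudoInner s z z = 1 → pseudoInner s (P z) z = 0 → z ∈ f '' U := by
  have hn := h.isUnitNormal_of_quadric hε hP hq
  have ha := h.isAdaptedFrame hn hy
  -- The surface is thickened in the directions `f` and `P f`. The derivative at `(y, 0, 0)` has the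
  -- adapted frame in its range, so `Φ` covers a neighbourhood of `f y`.
  let Φ : EuclideanSpace ℝ (Fin 2) × ℝ × ℝ → Fin 4 → ℝ :=
    fun p => (1 + p.2.1) • f p.1 + p.2.2 • P (f p.1)
  have hf : HasStrictFDerivAt f (fderiv ℝ f y) y := (h.smooth y hy).hasStrictFDerivAt (by simp)
  have hf1 : HasStrictFDerivAt (fun p : EuclideanSpace ℝ (Fin 2) × ℝ × ℝ => f p.1)
      ((fderiv ℝ f y).comp (.fst ℝ _ _)) (y, 0, 0) :=
    HasStrictFDerivAt.comp (y, (0 : ℝ), (0 : ℝ)) hf hasStrictFDerivAt_fst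
  have ha0 : HasStrictFDerivAt (fun p : EuclideanSpace ℝ (Fin 2) × ℝ × ℝ => p.2.1)
      ((ContinuousLinearMap.fst ℝ ℝ ℝ).comp (.snd ℝ _ _)) (y, 0, 0) :=
    HasStrictFDerivAt.comp (y, (0 : ℝ), (0 : ℝ)) (g := Prod.fst) (f := Prod.snd)
      hasStrictFDerivAt_fst hasStrictFDerivAt_snd
  have ha1 : HasStrictFDerivAt (fun p : EuclideanSpace ℝ (Fin 2) × ℝ × ℝ => 1 + p.2.1)
      ((ContinuousLinearMap.fst ℝ ℝ ℝ).comp (.snd ℝ _ _)) (y, 0, 0) :=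
    ha0.const_add 1
  have hb1 : HasStrictFDerivAt (fun p : EuclideanSpace ℝ (Fin 2) × ℝ × ℝ => p.2.2)
      ((ContinuousLinearMap.snd ℝ ℝ ℝ).comp (.snd ℝ _ _)) (y, 0, 0) :=
    HasStrictFDerivAt.comp (y, (0 : ℝ), (0 : ℝ)) (g := Prod.snd) (f := Prod.snd)
      hasStrictFDerivAt_snd hasStrictFDerivAt_snd
  have hΦ := (ha1.smul hf1).add (hb1.smul (P.hasStrictFDerivAt.comp (y, (0 : ℝ), (0 : ℝ)) hf1))
  have hmap := hΦ.map_nhds_eq_of_surj (by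
    rw [eq_top_iff, ← ha.basis.span_eq, Submodule.span_le]
    rintro _ ⟨a, rfl⟩
    rw [ha.basis_apply]
    fin_cases a
    · exact ⟨(0, 1, 0), by simp⟩
    · exact ⟨(EuclideanSpace.single 0 1, 0, 0), by simp [partialD]⟩
    · exact ⟨(EuclideanSpace.single 1 1, 0, 0), by simp [partialD]⟩
    · exact ⟨(0, 0, 1), by simp⟩)
  have hval : (1 + (0 : ℝ)) • f y + (0 : ℝ) • P (f y) = f y := by simp
  simp only [Pi.add_apply, Pi.smul_apply', hval] at hmap
  rw [← hmap, eventually_map]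
  have h1 : ∀ᶠ p : EuclideanSpace ℝ (Fin 2) × ℝ × ℝ in 𝓝 (y, 0, 0), p.1 ∈ U :=
    continuousAt_fst.eventually (h.isOpen.mem_nhds hy)
  have h2 : ∀ᶠ p : EuclideanSpace ℝ (Fin 2) × ℝ × ℝ in 𝓝 (y, 0, 0), -1 < p.2.1 :=
    ((continuous_fst.comp continuous_snd).continuousAt).eventually_const_lt (by simp)
  filter_upwards [h1, h2] with ⟨u, a, b⟩ hu hab hz1 hz2
  simp only at hu hab
  have e1 := h.unit u hu
  have e2 := hq u hu
  have e2' : pseudoInner s (f u) (P (f u)) = 0 := by rw [pseudoInner_comm, e2]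
  have e3 : pseudoInner s (P (f u)) (P (f u)) = ε := hn.unit u hu
  simp only [Pi.add_apply, Pi.smul_apply', map_add, map_smul, hP.sq,
    pseudoInner_add_left, pseudoInner_add_right, pseudoInner_smul_left, pseudoInner_smul_right,
    e1, e2, e2', e3] at hz1 hz2
  -- At a point of `Φ` the quadric equations become `(1 + a)² + ε b² = 1` and `2 ε (1 + a) b = 0`.
  -- With `a > -1` they force `b = 0`, then `a = 0`.
  have hb : b = 0 := by
    have h3 : (1 + a) * b = 0 := by linear_combination ε / 2 * hz2 - (1 + a) * b * hε
    exact (mul_eq_zero.1 h3).resolve_left (by linarith)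
  have haz : a = 0 := by
    have h3 : a * (2 + a) = 0 := by
      rw [hb] at hz1
      linear_combination hz1
    exact (mul_eq_zero.1 h3).resolve_right (by linarith)
  exact ⟨u, hu, by simp [haz, hb]⟩

end IsFlatMinimalPatch

end Rigidity

/-! ### From patches to the whole surface -/

section Global

variable {M : Type*} [TopologicalSpace M] [ChartedSpace (EuclideanSpace ℝ (Fin 2)) M]
    {s : ℕ} {ε : ℝ} {x : M → Fin 4 → ℝ}

theorem isFlatMinimalPatch_chart [IsManifold (𝓡 2) ∞ M]
    (hx : ContMDiff (𝓡 2) 𝓘(ℝ, Fin 4 → ℝ) ∞ x) (hsphere : ∀ p, x p ∈ pseudoSphere 3 s 1)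
    (hLorentz : IsLorentzianSurface s x) (hflat : IsFlatSurface s x)
    (hmean : HasZeroMeanCurvature s x) (p : M) :
    IsFlatMinimalPatch s (chartAt (EuclideanSpace ℝ (Fin 2)) p).target
      (x ∘ (chartAt (EuclideanSpace ℝ (Fin 2)) p).symm) := by
  have he := IsManifold.chart_mem_maximalAtlas (I := 𝓡 2) (n := ∞) p
  refine ⟨(chartAt _ p).open_target, fun y hy => ?_, fun y _ => ?_, hLorentz _ he, hflat _ he,
    hmean _ he⟩
  · have h1 := hx.comp_contMDiffOn (contMDiffOn_symm_of_mem_maximalAtlas he)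
    exact (contMDiffOn_iff_contDiffOn.1 h1).contDiffAt ((chartAt _ p).open_target.mem_nhds hy)
  · have := hsphere ((chartAt (EuclideanSpace ℝ (Fin 2)) p).symm y)
    simpa [pseudoSphere] using this

/-- A connected flat minimal Lorentzian surface is an open part of the quadric of a self-adjoint
operator with square `ε`. -/
theorem exists_range_eq_quadric [ConnectedSpace M] (hε : IsNormalSign s ε)
    (hpatch : ∀ p, IsFlatMinimalPatch s (chartAt (EuclideanSpace ℝ (Fin 2)) p).target
      (x ∘ (chartAt (EuclideanSpace ℝ (Fin 2)) p).symm)) (p₀ : M) :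
    ∃ P, IsSelfAdjointRoot s ε P ∧ (∃ v w, IsTangentFrame s P (x p₀) v w) ∧
      (∀ q, pseudoInner s (P (x q)) (x q) = 0) ∧
      ∃ W : Set (Fin 4 → ℝ), IsOpen W ∧
        Set.range x = {z | pseudoInner s z z = 1 ∧ pseudoInner s (P z) z = 0} ∩ W := by
  have hlocal (p : M) : ∃ P, IsSelfAdjointRoot s ε P ∧
      (∀ᶠ q in 𝓝 p, pseudoInner s (P (x q)) (x q) = 0) ∧ ∃ v w, IsTangentFrame s P (x p) v w := by
    obtain ⟨P, h1, h2, h3⟩ := (hpatch p).exists_selfAdjointRoot hε (mem_chart_target _ p)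
    refine ⟨P, h1, ?_, ?_⟩
    · exact ((chartAt (EuclideanSpace ℝ (Fin 2)) p).eventually_nhds'
        (fun q => pseudoInner s (P (x q)) (x q) = 0) (mem_chart_source _ p)).1 h2
    · simpa [(chartAt (EuclideanSpace ℝ (Fin 2)) p).left_inv (mem_chart_source _ p)] using h3
  obtain ⟨P, hP, hP₀, hframe⟩ := hlocal p₀
  have hopen (P : (Fin 4 → ℝ) →L[ℝ] (Fin 4 → ℝ)) :
      IsOpen {p | ∀ᶠ q in 𝓝 p, pseudoInner s (P (x q)) (x q) = 0} := by
    rw [isOpen_iff_mem_nhds]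
    intro p hp
    exact eventually_eventually_nhds.2 hp
  -- A limit point `p` has its own operator `P'`. Near `p` some point `q` admits both operators,
  -- hence `P = ± P'`, and the sign does not change the quadric.
  have hclosed : IsClosed {p | ∀ᶠ q in 𝓝 p, pseudoInner s (P (x q)) (x q) = 0} := by
    refine isClosed_of_closure_subset fun p hp => ?_
    obtain ⟨P', hP', hp', -⟩ := hlocal p
    obtain ⟨q, hq', hq⟩ := mem_closure_iff.1 hp _ (hopen P') hp'
    have htrans {P : (Fin 4 → ℝ) →L[ℝ] (Fin 4 → ℝ)}
        (h : ∀ᶠ r in 𝓝 q, pseudoInner s (P (x r)) (x r) = 0) :=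
      ((chartAt (EuclideanSpace ℝ (Fin 2)) q).eventually_nhds'
        (fun r => pseudoInner s (P (x r)) (x r) = 0) (mem_chart_source _ q)).2 h
    rcases (hpatch q).eq_or_eq_neg hε.mul_self (mem_chart_target _ q) hP hP' (htrans hq)
      (htrans hq') with rfl | rfl
    · exact hp'
    · simpa [pseudoInner_neg_left] using hp'
  have huniv := IsClopen.eq_univ ⟨hclosed, hopen P⟩ ⟨p₀, hP₀⟩
  have hall (q : M) : pseudoInner s (P (x q)) (x q) = 0 := by
    have hq : q ∈ {p | ∀ᶠ q in 𝓝 p, pseudoInner s (P (x q)) (x q) = 0} := huniv ▸ Set.mem_univ q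
    exact Eventually.self_of_nhds (p := fun q => pseudoInner s (P (x q)) (x q) = 0) hq
  -- `W` is the interior of the set where lying on the quadric implies lying on the surface; local
  -- filling puts every `x q` in it.
  refine ⟨P, hP, hframe, hall, interior {z | pseudoInner s z z = 1 → pseudoInner s (P z) z = 0 →
    z ∈ Set.range x}, isOpen_interior, ?_⟩
  apply Set.Subset.antisymm
  · rintro _ ⟨q, rfl⟩
    have hxq : (x ∘ (chartAt (EuclideanSpace ℝ (Fin 2)) q).symm)
        (chartAt (EuclideanSpace ℝ (Fin 2)) q q) = x q := by
      simp [(chartAt (EuclideanSpace ℝ (Fin 2)) q).left_inv (mem_chart_source _ q)]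
    refine ⟨⟨?_, hall q⟩, ?_⟩
    · rw [← hxq]
      exact (hpatch q).unit _ (mem_chart_target _ q)
    · rw [mem_interior_iff_mem_nhds, ← hxq]
      filter_upwards [(hpatch q).eventually_mem_image hε.mul_self (mem_chart_target _ q) hP
        fun z _ => hall _] with z hz hz1 hz2
      obtain ⟨u, -, rfl⟩ := hz hz1 hz2
      exact ⟨_, rfl⟩
  · rintro z ⟨⟨hz1, hz2⟩, hz⟩
    exact interior_subset hz hz1 hz2

end Global

/-! ### Orthonormal frames and implicit equations of the two models -/

section Models

variable {s : ℕ}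

/-- A basis of `𝔼^4_s` that is orthonormal with the signs of the standard basis. -/
def IsOrthonormalFrame (s : ℕ) (E : Fin 4 → Fin 4 → ℝ) : Prop :=
  ∀ i j, pseudoInner s (E i) (E j) = if i = j then (if i.val + s < 4 then 1 else -1) else 0

theorem IsOrthonormalFrame.pseudoInner_frameMap {E : Fin 4 → Fin 4 → ℝ}
    (hE : IsOrthonormalFrame s E) (c d : Fin 4 → ℝ) :
    pseudoInner s (frameMap E c) (frameMap E d) = pseudoInner s c d := by
  rw [frameMap_apply, frameMap_apply, pseudoInner_sum_left, pseudoInner]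
  refine Finset.sum_congr rfl fun i _ => ?_
  rw [pseudoInner_sum_right, Finset.sum_eq_single i]
  · rw [pseudoInner_smul_left, pseudoInner_smul_right, hE i i, if_pos rfl]
    ring
  · intro j _ hj
    rw [pseudoInner_smul_left, pseudoInner_smul_right, hE i j, if_neg hj.symm]
    ring
  · simp

theorem IsOrthonormalFrame.exists_linearEquiv {E : Fin 4 → Fin 4 → ℝ}
    (hE : IsOrthonormalFrame s E) :
    ∃ A : (Fin 4 → ℝ) ≃ₗ[ℝ] (Fin 4 → ℝ), ∀ c, A.symm c = frameMap E c := by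
  have hinj : Function.Injective (frameMap E : (Fin 4 → ℝ) →ₗ[ℝ] (Fin 4 → ℝ)) := by
    rw [← LinearMap.ker_eq_bot, LinearMap.ker_eq_bot']
    intro c hc
    refine pseudoInner_nondegenerate s fun d => ?_
    rw [← hE.pseudoInner_frameMap]
    have hc' : frameMap E c = 0 := hc
    rw [hc', pseudoInner_zero_left]
  exact ⟨(LinearEquiv.ofInjectiveEndo _ hinj).symm, fun c => rfl⟩

/-- Only the inclusion of `S` in the quadric `Q` is required, not equality. This allows `S` to be a
single sheet of `Q`, provided that `T` stays on that sheet. -/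
theorem IsOrthonormalFrame.congruentToOpenPart {E : Fin 4 → Fin 4 → ℝ}
    (hE : IsOrthonormalFrame s E) {T S Q W : Set (Fin 4 → ℝ)} (hW : IsOpen W) (hT : T = Q ∩ W)
    (h1 : ∀ c, frameMap E c ∈ T → c ∈ S) (h2 : ∀ c ∈ S, frameMap E c ∈ Q) :
    CongruentToOpenPart s T S := by
  obtain ⟨A, hA⟩ := hE.exists_linearEquiv
  refine ⟨A, fun v w => ?_, frameMap E ⁻¹' W, hW.preimage (frameMap E).continuous, ?_⟩
  · rw [← hE.pseudoInner_frameMap, ← hA, ← hA, A.symm_apply_apply, A.symm_apply_apply]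
  · ext c
    constructor
    · rintro ⟨z, hz, rfl⟩
      have hz' : frameMap E (A z) = z := by rw [← hA, A.symm_apply_apply]
      refine ⟨h1 _ (by rwa [hz']), ?_⟩
      rw [Set.mem_preimage, hz']
      rw [hT] at hz
      exact hz.2
    · rintro ⟨hc, hcW⟩
      refine ⟨frameMap E c, ?_, by rw [← hA, A.apply_symm_apply]⟩
      rw [hT]
      exact ⟨h2 c hc, hcW⟩

theorem exists_cos_sin {a b r : ℝ} (hr : 0 < r) (h : a ^ 2 + b ^ 2 = r ^ 2) :
    ∃ t, a = r * Real.cos t ∧ b = r * Real.sin t := by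
  have hn : ‖(⟨a, b⟩ : ℂ)‖ = r := by
    rw [Complex.norm_eq_sqrt_sq_add_sq, h, Real.sqrt_sq hr.le]
  refine ⟨Complex.arg ⟨a, b⟩, ?_, ?_⟩
  · rw [← hn, Complex.norm_mul_cos_arg]
  · rw [← hn, Complex.norm_mul_sin_arg]

theorem exists_cosh_sinh {a b r : ℝ} (hr : 0 < r) (ha : 0 < a) (h : a ^ 2 - b ^ 2 = r ^ 2) :
    ∃ t, a = r * Real.cosh t ∧ b = r * Real.sinh t := by
  have hb : b = r * Real.sinh (Real.arsinh (b / r)) := by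
    rw [Real.sinh_arsinh]
    field_simp
  refine ⟨Real.arsinh (b / r), ?_, hb⟩
  have h1 := Real.cosh_sq (Real.arsinh (b / r))
  have h2 : a ^ 2 = (r * Real.cosh (Real.arsinh (b / r))) ^ 2 := by
    rw [mul_pow, h1, mul_add, ← mul_pow, ← hb]
    linarith
  exact (pow_left_inj₀ ha.le (by positivity) two_ne_zero).1 h2

theorem mem_range_lorentzCliffordTorus {c : Fin 4 → ℝ} :
    c ∈ Set.range lorentzCliffordTorus ↔
      c 0 ^ 2 + c 1 ^ 2 = 1 / 2 ∧ c 2 ^ 2 - c 3 ^ 2 = 1 / 2 ∧ 0 < c 2 := by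
  have hr : (1 / √2 : ℝ) ^ 2 = 1 / 2 := by
    rw [div_pow, Real.sq_sqrt (by norm_num)]
    norm_num
  have hr0 : (0 : ℝ) < 1 / √2 := by positivity
  constructor
  · rintro ⟨⟨u, v⟩, rfl⟩
    simp only [lorentzCliffordTorus, Pi.smul_apply, smul_eq_mul, Matrix.cons_val_zero,
      Matrix.cons_val_one, Matrix.cons_val]
    refine ⟨?_, ?_, mul_pos hr0 (Real.cosh_pos v)⟩
    · rw [mul_pow, mul_pow, ← mul_add, Real.cos_sq_add_sin_sq, hr, mul_one]
    · rw [mul_pow, mul_pow, ← mul_sub, Real.cosh_sq_sub_sinh_sq, hr, mul_one]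
  · rintro ⟨h1, h2, h3⟩
    rw [← hr] at h1 h2
    obtain ⟨u, hu0, hu1⟩ := exists_cos_sin hr0 h1
    obtain ⟨v, hv0, hv1⟩ := exists_cosh_sinh hr0 h3 h2
    refine ⟨(u, v), ?_⟩
    funext i
    fin_cases i
    exacts [hu0.symm, hu1.symm, hv0.symm, hv1.symm]

theorem mem_range_tensorProductSurface {c : Fin 4 → ℝ} :
    c ∈ Set.range tensorProductSurface ↔
      c 0 ^ 2 + c 1 ^ 2 - c 2 ^ 2 - c 3 ^ 2 = 1 ∧ c 0 * c 3 - c 1 * c 2 = 0 := by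
  constructor
  · rintro ⟨⟨u, v⟩, rfl⟩
    simp only [tensorProductSurface, Matrix.cons_val_zero, Matrix.cons_val_one, Matrix.cons_val]
    refine ⟨?_, by ring⟩
    linear_combination Real.cosh_sq_sub_sinh_sq u +
      (Real.cosh u ^ 2 - Real.sinh u ^ 2) * Real.cos_sq_add_sin_sq v
  · rintro ⟨h1, h2⟩
    have hpos : 0 < c 0 ^ 2 + c 1 ^ 2 := by nlinarith [sq_nonneg (c 2), sq_nonneg (c 3)]
    have hr : 0 < √(c 0 ^ 2 + c 1 ^ 2) := Real.sqrt_pos.2 hpos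
    have hrr := Real.sq_sqrt hpos.le
    set r := √(c 0 ^ 2 + c 1 ^ 2)
    obtain ⟨v, hv0, hv1⟩ := exists_cos_sin hr hrr.symm
    have hcs := Real.cos_sq_add_sin_sq v
    -- The second equation makes `(c 2, c 3)` parallel to `(c 0, c 1)`, so it is `sinh u (cos v, sin
    -- v)` with `sinh u` its component along `(cos v, sin v)`.
    have hk : c 3 * Real.cos v = c 2 * Real.sin v := by
      rw [hv0, hv1] at h2
      refine mul_left_cancel₀ hr.ne' ?_
      linear_combination h2
    have h3 : r ^ 2 - (c 2 * Real.cos v + c 3 * Real.sin v) ^ 2 = 1 ^ 2 := by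
      rw [hrr]
      linear_combination h1 - (c 2 ^ 2 + c 3 ^ 2) * hcs
        + (c 3 * Real.cos v - c 2 * Real.sin v) * hk
    obtain ⟨u, hu0, hu1⟩ := exists_cosh_sinh one_pos hr h3
    rw [one_mul] at hu0 hu1
    refine ⟨(u, v), ?_⟩
    funext i
    fin_cases i
    · exact (by rw [hv0, hu0] : c 0 = Real.cosh u * Real.cos v).symm
    · exact (by rw [hv1, hu0] : c 1 = Real.cosh u * Real.sin v).symm
    · have : c 2 = Real.sinh u * Real.cos v := by
        rw [← hu1]
        linear_combination -c 2 * hcs - Real.sin v * hk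
      exact this.symm
    · have : c 3 = Real.sinh u * Real.sin v := by
        rw [← hu1]
        linear_combination -c 3 * hcs + Real.cos v * hk
      exact this.symm

end Models

/-! ### Normal forms of `P` and congruence with the models -/

section Classification

variable {s : ℕ} {ε : ℝ} {P : (Fin 4 → ℝ) →L[ℝ] (Fin 4 → ℝ)} {x v w : Fin 4 → ℝ}

theorem IsTangentFrame.neg_operator (h : IsTangentFrame s P x v w) :
    IsTangentFrame s (-P) x v w where
  vv := h.vv
  ww := h.ww
  vw := h.vw
  xv := h.xv
  xw := h.xw
  nv := by simp [pseudoInner_neg_left, h.nv]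
  nw := by simp [pseudoInner_neg_left, h.nw]
  diag := by simp [pseudoInner_neg_left, h.diag]

/-- Reversing `w` changes the sign of `⟨P v, w⟩`, which serves to normalize that sign when `ε = -1`.
-/
theorem IsTangentFrame.neg_right (h : IsTangentFrame s P x v w) :
    IsTangentFrame s P x v (-w) where
  vv := h.vv
  ww := by rw [pseudoInner_neg_left, pseudoInner_neg_right, neg_neg, h.ww]
  vw := by rw [pseudoInner_neg_right, h.vw, neg_zero]
  xv := h.xv
  xw := by rw [pseudoInner_neg_right, h.xw, neg_zero]
  nv := h.nv
  nw := by rw [pseudoInner_neg_right, h.nw, neg_zero]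
  diag := by rw [map_neg, pseudoInner_neg_left, pseudoInner_neg_right, neg_neg, h.diag]

/-- `P` preserves the tangent plane, with `P v = p v - q w` for `p = ⟨P v, v⟩`, `q = ⟨P v, w⟩`, the
minus sign because `w` is timelike. Now `⟨P v, P v⟩ = ⟨P² v, v⟩ = ε`. So `p ≠ 0` for `ε = 1` and `q
≠ 0` for `ε = -1`. -/
theorem IsTangentFrame.sq_sub_sq (h : IsTangentFrame s P x v w) (hε : ε * ε = 1)
    (hP : IsSelfAdjointRoot s ε P) (hx : pseudoInner s x x = 1)
    (hPx : pseudoInner s (P x) x = 0) :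
    pseudoInner s (P v) v ^ 2 - pseudoInner s (P v) w ^ 2 = ε := by
  have ha : IsAdaptedFrame s ε x (P x) ![v, w] := by
    refine ⟨hx, by rw [pseudoInner_comm, hPx], ?_, ?_, ?_, ?_, hε⟩
    · rw [← hP.selfAdjoint, hP.sq, pseudoInner_smul_left, hx, mul_one]
    · simp [Fin.forall_fin_two, h.xv, h.xw]
    · simp [Fin.forall_fin_two, h.nv, h.nw]
    · simp [Matrix.det_fin_two, h.vv, h.ww, h.vw]
  have hwv : pseudoInner s w v = 0 := by rw [pseudoInner_comm, h.vw]
  have hexp : P v = pseudoInner s (P v) v • v - pseudoInner s (P v) w • w := by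
    refine ha.ext ?_ ?_ ?_
    · rw [hP.selfAdjoint, pseudoInner_comm, h.nv]
      simp [pseudoInner_sub_left, pseudoInner_smul_left, pseudoInner_comm s v x,
        pseudoInner_comm s w x, h.xv, h.xw]
    · rw [hP.selfAdjoint, hP.sq, pseudoInner_smul_right]
      simp [pseudoInner_sub_left, pseudoInner_smul_left, pseudoInner_comm s v,
        pseudoInner_comm s w, h.xv, h.nv, h.nw]
    · simp [Fin.forall_fin_two, pseudoInner_sub_left, pseudoInner_smul_left, h.vv, h.ww, h.vw, hwv]
  have h1 : pseudoInner s (P v) (P v) = ε := by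
    rw [← hP.selfAdjoint, hP.sq, pseudoInner_smul_left, h.vv, mul_one]
  conv_lhs at h1 => rhs; rw [hexp]
  rw [pseudoInner_sub_right, pseudoInner_smul_right, pseudoInner_smul_right] at h1
  linear_combination h1

/-- `P` is an involution, so `z + P z` and `z - P z` are eigenvectors, and eigenvectors for opposite
eigenvalues are orthogonal. The squares of `v + P v` and `w - P w` are `2 (1 + p)` and `-2 (1 + p)`,
so `p > 0` allows normalization; the squares of `x ± P x` are `2`. -/
theorem exists_orthonormalFrame_one (h : IsTangentFrame 1 P x v w) (hP : IsSelfAdjointRoot 1 1 P)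
    (hx : pseudoInner 1 x x = 1) (hPx : pseudoInner 1 (P x) x = 0)
    (hp : 0 < pseudoInner 1 (P v) v) :
    ∃ E, IsOrthonormalFrame 1 E ∧ P (E 0) = E 0 ∧ P (E 1) = E 1 ∧ P (E 2) = -E 2 ∧
      P (E 3) = -E 3 ∧ 0 < pseudoInner 1 x (E 2) := by
  obtain ⟨c, hc0, hc⟩ : ∃ c : ℝ, 0 < c ∧ c * (c * 2) = 1 := by
    refine ⟨(√2)⁻¹, by positivity, ?_⟩
    rw [← mul_assoc, ← mul_inv, Real.mul_self_sqrt (by norm_num)]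
    norm_num
  set p := pseudoInner 1 (P v) v with hpdef
  obtain ⟨r, hr⟩ : ∃ r : ℝ, r * (r * (2 * (1 + p))) = 1 := by
    refine ⟨(√(2 * (1 + p)))⁻¹, ?_⟩
    rw [← mul_assoc, ← mul_inv, Real.mul_self_sqrt (by positivity)]
    field_simp
  have hzP (z z' : Fin 4 → ℝ) : pseudoInner 1 z (P z') = pseudoInner 1 (P z) z' :=
    (hP.selfAdjoint z z').symm
  have hvx : pseudoInner 1 v x = 0 := by rw [pseudoInner_comm, h.xv]
  have hwx : pseudoInner 1 w x = 0 := by rw [pseudoInner_comm, h.xw]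
  have hwv : pseudoInner 1 w v = 0 := by rw [pseudoInner_comm, h.vw]
  have hnvx : pseudoInner 1 (P v) x = 0 := by rw [hP.selfAdjoint, pseudoInner_comm, h.nv]
  have hnwx : pseudoInner 1 (P w) x = 0 := by rw [hP.selfAdjoint, pseudoInner_comm, h.nw]
  have hPwv : pseudoInner 1 (P w) v = pseudoInner 1 (P v) w := by
    rw [hP.selfAdjoint, pseudoInner_comm]
  have hPww : pseudoInner 1 (P w) w = p := h.diag.symm
  have hsq (z : Fin 4 → ℝ) : P (P z) = z := by rw [hP.sq, one_smul]
  refine ⟨![c • (x + P x), r • (v + P v), c • (x - P x),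
    r • (w - P w)], ?_, ?_, ?_, ?_, ?_, ?_⟩
  · intro i j
    fin_cases i <;> fin_cases j <;>
      simp [pseudoInner_smul_left, pseudoInner_smul_right, pseudoInner_add_left,
        pseudoInner_add_right, pseudoInner_sub_left, pseudoInner_sub_right, hsq, hzP, hx, hPx, h.vv,
        h.ww, h.vw, h.xv, h.xw, h.nv, h.nw, hvx, hwx, hwv, hnvx, hnwx, hPwv, hPww, ← hpdef]
    · linear_combination hc
    · linear_combination hr
    · linear_combination hc
    · linear_combination -hr
  · simp [hsq, add_comm]
  · simp [hsq, add_comm]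
  · simp [hsq, ← smul_neg]
  · simp [hsq, ← smul_neg]
  · simp [pseudoInner_smul_right, pseudoInner_sub_right, hzP, hx, hPx, hc0]

/-- `P` is a complex structure, with `P (v - P w) = P v + w`. These two vectors have squares `± 2 (1
- q)`, positive and negative since `q < 0`, and they are orthogonal because `P` has equal diagonal
values on `v` and `w`. The plane of `x, P x` supplies the rest. -/
theorem exists_orthonormalFrame_two (h : IsTangentFrame 2 P x v w)
    (hP : IsSelfAdjointRoot 2 (-1) P) (hx : pseudoInner 2 x x = 1)
    (hPx : pseudoInner 2 (P x) x = 0) (hq : pseudoInner 2 (P v) w < 0) :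
    ∃ E, IsOrthonormalFrame 2 E ∧ P (E 0) = -E 3 ∧ P (E 1) = E 2 ∧ P (E 2) = -E 1 ∧
      P (E 3) = E 0 := by
  set q := pseudoInner 2 (P v) w with hqdef
  have hq0 : 0 < 1 - q := by linarith
  obtain ⟨r, hr⟩ : ∃ r : ℝ, r * (r * (2 * (1 - q))) = 1 := by
    refine ⟨(√(2 * (1 - q)))⁻¹, ?_⟩
    rw [← mul_assoc, ← mul_inv, Real.mul_self_sqrt (by positivity)]
    field_simp
  have hzP (z z' : Fin 4 → ℝ) : pseudoInner 2 z (P z') = pseudoInner 2 (P z) z' :=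
    (hP.selfAdjoint z z').symm
  have hvx : pseudoInner 2 v x = 0 := by rw [pseudoInner_comm, h.xv]
  have hwx : pseudoInner 2 w x = 0 := by rw [pseudoInner_comm, h.xw]
  have hwv : pseudoInner 2 w v = 0 := by rw [pseudoInner_comm, h.vw]
  have hnvx : pseudoInner 2 (P v) x = 0 := by rw [hP.selfAdjoint, pseudoInner_comm, h.nv]
  have hnwx : pseudoInner 2 (P w) x = 0 := by rw [hP.selfAdjoint, pseudoInner_comm, h.nw]
  have hPwv : pseudoInner 2 (P w) v = q := by
    rw [hP.selfAdjoint, pseudoInner_comm]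
  have hsq (z : Fin 4 → ℝ) : P (P z) = -z := by rw [hP.sq, neg_one_smul]
  refine ⟨![x, r • (v - P w), r • (P v + w), -P x],
    ?_, ?_, ?_, ?_, ?_⟩
  · intro i j
    fin_cases i <;> fin_cases j <;>
      simp [pseudoInner_smul_left, pseudoInner_smul_right, pseudoInner_add_left,
        pseudoInner_add_right, pseudoInner_sub_left, pseudoInner_sub_right, pseudoInner_neg_left,
        pseudoInner_neg_right, hsq, hzP, hx, hPx, h.vv, h.diag,
        h.ww, h.vw, h.xv, h.xw, h.nv, h.nw, hvx, hwx, hwv, hnvx, hnwx, hPwv, ← hqdef]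
    · linear_combination hr
    · linear_combination -hr
  · simp
  · simp [hsq]
  · simp only [Matrix.cons_val, Matrix.cons_val_one, map_smul, map_add, hsq, ← smul_neg]
    congr 1
    abel
  · simp [hsq]

theorem congruentToOpenPart_lorentzCliffordTorus {M : Type*} [TopologicalSpace M]
    [ConnectedSpace M] {x : M → Fin 4 → ℝ} (hxc : Continuous x) (p₀ : M)
    (hP : IsSelfAdjointRoot 1 1 P) (h : IsTangentFrame 1 P (x p₀) v w)
    (hp : 0 < pseudoInner 1 (P v) v) {W : Set (Fin 4 → ℝ)} (hW : IsOpen W)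
    (hrange : Set.range x = {z | pseudoInner 1 z z = 1 ∧ pseudoInner 1 (P z) z = 0} ∩ W) :
    CongruentToOpenPart 1 (Set.range x) (Set.range lorentzCliffordTorus) := by
  have hx (q : M) : pseudoInner 1 (x q) (x q) = 1 ∧ pseudoInner 1 (P (x q)) (x q) = 0 := by
    have : x q ∈ Set.range x := ⟨q, rfl⟩
    rw [hrange] at this
    exact this.1
  obtain ⟨E, hE, h0, h1, h2, h3, hpos⟩ := exists_orthonormalFrame_one h hP (hx p₀).1 (hx p₀).2 hp
  have hPE (c : Fin 4 → ℝ) : P (frameMap E c) = frameMap E ![c 0, c 1, -c 2, -c 3] := by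
    simp [frameMap_apply, Fin.sum_univ_four, h0, h1, h2, h3]
  have hQ (c : Fin 4 → ℝ) : pseudoInner 1 (frameMap E c) (frameMap E c) = 1 ∧
      pseudoInner 1 (P (frameMap E c)) (frameMap E c) = 0 ↔
      c 0 ^ 2 + c 1 ^ 2 = 1 / 2 ∧ c 2 ^ 2 - c 3 ^ 2 = 1 / 2 := by
    rw [hPE, hE.pseudoInner_frameMap, hE.pseudoInner_frameMap, pseudoInner_one, pseudoInner_one]
    simp only [Matrix.cons_val_zero, Matrix.cons_val_one, Matrix.cons_val]
    constructor
    · rintro ⟨e1, e2⟩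
      constructor
      · linear_combination (e1 + e2) / 2
      · linear_combination (e1 - e2) / 2
    · rintro ⟨e1, e2⟩
      constructor
      · linear_combination e1 + e2
      · linear_combination e1 - e2
  have hcoord (c : Fin 4 → ℝ) : pseudoInner 1 (frameMap E c) (E 2) = c 2 := by
    rw [← frameMap_single E 2, hE.pseudoInner_frameMap, pseudoInner_one]
    simp
  obtain ⟨A, hA⟩ := hE.exists_linearEquiv
  -- The quadric has two sheets, separated by the sign of the coordinate along `E 2`, since `c 2 ^ 2
  -- = 1 / 2 + c 3 ^ 2`. Connectedness of `M` keeps the surface on the sheet of `x p₀`, where this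
  -- sign is positive.
  have hne (q : M) : pseudoInner 1 (x q) (E 2) ≠ 0 := by
    have hq := hx q
    rw [← A.symm_apply_apply (x q), hA, hQ] at hq
    rw [← A.symm_apply_apply (x q), hA, hcoord]
    intro hzero
    have h4 := hq.2
    rw [hzero] at h4
    nlinarith [sq_nonneg (A (x q) 3)]
  have hcont : Continuous fun q => pseudoInner 1 (x q) (E 2) :=
    ((pseudoFormL 1).flip (E 2)).continuous.comp hxc
  have hposall (q : M) : 0 < pseudoInner 1 (x q) (E 2) := by
    by_contra hcon
    obtain ⟨r, hr⟩ := intermediate_value_univ q p₀ hcont ⟨not_lt.1 hcon, hpos.le⟩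
    exact hne r hr
  refine hE.congruentToOpenPart hW hrange ?_ ?_
  · rintro c ⟨q, hq⟩
    have h4 := hx q
    have h5 := hposall q
    rw [hq, hQ] at h4
    rw [hq, hcoord] at h5
    exact mem_range_lorentzCliffordTorus.2 ⟨h4.1, h4.2, h5⟩
  · intro c hc
    obtain ⟨h4, h5, -⟩ := mem_range_lorentzCliffordTorus.1 hc
    exact (hQ c).2 ⟨h4, h5⟩

theorem congruentToOpenPart_tensorProductSurface (hP : IsSelfAdjointRoot 2 (-1) P)
    (h : IsTangentFrame 2 P x v w) (hx : pseudoInner 2 x x = 1)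
    (hPx : pseudoInner 2 (P x) x = 0) (hq : pseudoInner 2 (P v) w < 0) {T W : Set (Fin 4 → ℝ)}
    (hW : IsOpen W)
    (hT : T = {z | pseudoInner 2 z z = 1 ∧ pseudoInner 2 (P z) z = 0} ∩ W) :
    CongruentToOpenPart 2 T (Set.range tensorProductSurface) := by
  obtain ⟨E, hE, h0, h1, h2, h3⟩ := exists_orthonormalFrame_two h hP hx hPx hq
  have hPE (c : Fin 4 → ℝ) : P (frameMap E c) = frameMap E ![c 3, -c 2, c 1, -c 0] := by
    simp [frameMap_apply, Fin.sum_univ_four, h0, h1, h2, h3]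
    abel
  have hQ (c : Fin 4 → ℝ) : pseudoInner 2 (frameMap E c) (frameMap E c) = 1 ∧
      pseudoInner 2 (P (frameMap E c)) (frameMap E c) = 0 ↔
      c ∈ Set.range tensorProductSurface := by
    rw [hPE, hE.pseudoInner_frameMap, hE.pseudoInner_frameMap, pseudoInner_two, pseudoInner_two,
      mem_range_tensorProductSurface]
    simp only [Matrix.cons_val_zero, Matrix.cons_val_one, Matrix.cons_val]
    refine and_congr ⟨fun e => by linear_combination e, fun e => by linear_combination e⟩
      ⟨fun e => by linear_combination e / 2, fun e => by linear_combination 2 * e⟩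
  refine hE.congruentToOpenPart hW hT (fun c hc => ?_) fun c hc => (hQ c).2 hc
  rw [hT] at hc
  exact (hQ c).1 hc.1

/-- A Lorentzian tangent plane to the pseudo-sphere exists only for index one or two. -/
theorem index_eq_one_or_two (hs : s ≤ 3) (hx : pseudoInner s x x = 1)
    (hv : pseudoInner s v v = 1) (hw : pseudoInner s w w = -1) (hxv : pseudoInner s x v = 0) :
    s = 1 ∨ s = 2 := by
  interval_cases s
  · simp [pseudoInner, Fin.sum_univ_four] at hw
    nlinarith [mul_self_nonneg (w 0), mul_self_nonneg (w 1), mul_self_nonneg (w 2),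
      mul_self_nonneg (w 3)]
  · simp
  · simp
  -- For index 3 there is one positive direction, so `x` and `v` cannot both be spacelike and
  -- orthogonal: `(1 + |x'|²)(1 + |v'|²) = (x' · v')²` would violate Cauchy–Schwarz for the last
  -- three coordinates.
  · simp [pseudoInner, Fin.sum_univ_four] at hx hv hxv
    have e1 : (x 0 * v 0) * (x 0 * v 0) = (x 1 * v 1 + x 2 * v 2 + x 3 * v 3) ^ 2 := by
      have : x 0 * v 0 = x 1 * v 1 + x 2 * v 2 + x 3 * v 3 := by linear_combination hxv
      rw [this]
      ring
    have e2 : x 0 * x 0 = 1 + (x 1 * x 1 + x 2 * x 2 + x 3 * x 3) := by linear_combination hx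
    have e3 : v 0 * v 0 = 1 + (v 1 * v 1 + v 2 * v 2 + v 3 * v 3) := by linear_combination hv
    have e4 : (1 + (x 1 * x 1 + x 2 * x 2 + x 3 * x 3)) *
        (1 + (v 1 * v 1 + v 2 * v 2 + v 3 * v 3)) = (x 1 * v 1 + x 2 * v 2 + x 3 * v 3) ^ 2 := by
      rw [← e1, ← e2, ← e3]
      ring
    nlinarith [sq_nonneg (x 1 * v 2 - x 2 * v 1), sq_nonneg (x 1 * v 3 - x 3 * v 1),
      sq_nonneg (x 2 * v 3 - x 3 * v 2), mul_self_nonneg (x 1), mul_self_nonneg (x 2),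
      mul_self_nonneg (x 3), mul_self_nonneg (v 1), mul_self_nonneg (v 2), mul_self_nonneg (v 3)]

end Classification

/-! ### The classification theorem -/

theorem lemma2 {M : Type*} [TopologicalSpace M] [ConnectedSpace M]
    [ChartedSpace (EuclideanSpace ℝ (Fin 2)) M] [IsManifold (𝓡 2) ∞ M]
    (s : ℕ) (hs : s ≤ 3) (x : M → Fin 4 → ℝ)
    (hx : ContMDiff (𝓡 2) 𝓘(ℝ, Fin 4 → ℝ) ∞ x)
    (hsphere : ∀ p, x p ∈ pseudoSphere 3 s 1)
    (hLorentz : IsLorentzianSurface s x)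
    (hflat : IsFlatSurface s x)
    (hmean : HasZeroMeanCurvature s x) :
    (s = 1 ∧ CongruentToOpenPart s (Set.range x) (Set.range lorentzCliffordTorus)) ∨
    (s = 2 ∧ CongruentToOpenPart s (Set.range x) (Set.range tensorProductSurface)) := by
  have hpatch := isFlatMinimalPatch_chart hx hsphere hLorentz hflat hmean
  obtain ⟨p₀⟩ : Nonempty M := inferInstance
  have hunit : pseudoInner s (x p₀) (x p₀) = 1 := by simpa [pseudoSphere] using hsphere p₀
  have hindex : s = 1 ∨ s = 2 := by
    have hp₀ := mem_chart_target (EuclideanSpace ℝ (Fin 2)) p₀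
    obtain ⟨v, w, hv, hw, -⟩ := (hpatch p₀).lorentz _ hp₀
    refine index_eq_one_or_two hs ((hpatch p₀).unit _ hp₀) hv hw ?_
    simp [fderiv_eq_sum_partialD, pseudoInner_add_right, pseudoInner_smul_right,
      (hpatch p₀).position_tangent hp₀, -Function.comp_apply]
  rcases hindex with rfl | rfl
  · refine Or.inl ⟨rfl, ?_⟩
    have hε : IsNormalSign 1 1 := Or.inl ⟨rfl, rfl⟩
    obtain ⟨P, hP, ⟨v, w, hvw⟩, hq, W, hW, hrange⟩ := exists_range_eq_quadric hε hpatch p₀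
    have hsq := hvw.sq_sub_sq hε.mul_self hP hunit (hq p₀)
    have hp : pseudoInner 1 (P v) v ≠ 0 := by
      intro h0
      rw [h0] at hsq
      nlinarith [sq_nonneg (pseudoInner 1 (P v) w)]
    -- `P` and `-P` define the same quadric, so `⟨P v, v⟩` may be taken positive.
    rcases hp.lt_or_gt with hp | hp
    · refine congruentToOpenPart_lorentzCliffordTorus hx.continuous p₀ hP.neg hvw.neg_operator
        ?_ hW ?_
      · simpa [pseudoInner_neg_left] using hp
      · simpa [pseudoInner_neg_left] using hrange
    · exact congruentToOpenPart_lorentzCliffordTorus hx.continuous p₀ hP hvw hp hW hrange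
  · refine Or.inr ⟨rfl, ?_⟩
    have hε : IsNormalSign 2 (-1) := Or.inr ⟨rfl, rfl⟩
    obtain ⟨P, hP, ⟨v, w, hvw⟩, hq, W, hW, hrange⟩ := exists_range_eq_quadric hε hpatch p₀
    have hsq := hvw.sq_sub_sq hε.mul_self hP hunit (hq p₀)
    have hp : pseudoInner 2 (P v) w ≠ 0 := by
      intro h0
      rw [h0] at hsq
      nlinarith [sq_nonneg (pseudoInner 2 (P v) v)]
    rcases hp.lt_or_gt with hp | hp
    · exact congruentToOpenPart_tensorProductSurface hP hvw hunit (hq p₀) hp hW hrange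
    · refine congruentToOpenPart_tensorProductSurface hP hvw.neg_right hunit (hq p₀) ?_ hW hrange
      rw [pseudoInner_neg_right]
      exact neg_neg_of_pos hp
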